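/- Let $n\ge 0$, let $G$ be a finite abelian group, and let $K$ be a splitting field for $G$ (that is, every simple $KG$-module stays simple after extending scalars to the algebraic closure of $K$) whose characteristic does not divide $|G|$. Put $\widehat G=\operatorname{Hom}(G,K^\times)$. Let $\Pi_n$ be the set of set partitions of $\{1,\dots,n\}$, ordered by $X\le Y$ if every block of $X$ is contained in a block of $Y$, and let $|X|$ be the number of blocks of $X$. Let $\Sigma_n$ be the monoid of ordered set partitions of $\{1,\dots,n\}$ with product $$(P_1,\dots,P_r)(Q_1,\dots,Q_s)=(P_1\cap Q_1,\dots,P_1\cap Q_s,P_2\cap Q_1,\dots,P_r\cap Q_s)^\wedge,$$ where $\wedge$ means that empty intersections are omitted, and write $\sigma(\pi)\in\Pi_n$ for the set partition underlying $\pi\in\Sigma_n$. Let $\Sigma_n^G$ be the submonoid of $\Sigma_n\times G^n$ of all pairs $(\pi,g)$ such that $g_i=g_j$ whenever $i,j$ lie in the same block of $\sigma(\pi)$. For $X\in\Pi_n$ and $f\colon X\to\widehat G$ (a character $f(P)$ for each block $P$ of $X$), let $(X,f)$ be the simple left $K\Sigma_n^G$-module with underlying space $K$ on which $(\pi,g)\in\Sigma_n^G$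 acts as multiplication by $\prod_{P\in X}f(P)(g_P)$ if $X\le\sigma(\pi)$, where $g_P$ is the common value of the $g_i$ with $i\in P$, and as $0$ otherwise. Then for all $X,Y\in\Pi_n$, all $f\colon X\to\widehat G$ and $h\colon Y\to\widehat G$, and all integers $q\ge0$: if $$X\le Y,\qquad q=|X|-|Y|,\qquad h(P)=\prod_{Q\in X,\;Q\subseteq P}f(Q)\ \text{ in }\widehat G\text{ for every block }P\in Y,$$ then $\operatorname{Ext}^q_{K\Sigma_n^G}\big((X,f),(Y,h)\big)\cong K$ as $K$-vector spaces; and if these three conditions do not all hold, then $\operatorname{Ext}^q_{K\Sigma_n^G}\big((X,f),(Y,h)\big)=0$. -/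

import Mathlib

universe u v

/-! ### Ordered set partitions -/

/-- An ordered set partition `(P₁, …, P_r)` of an `n`-element set: a list of nonempty, pairwise
disjoint subsets that cover the set. -/
@[ext]
structure OrderedSetPartition (n : ℕ) where
  /-- The list of blocks. -/
  blocks : List (Finset (Fin n))
  nonempty : ∀ P ∈ blocks, P.Nonempty
  disjoint : blocks.Pairwise Disjoint
  cover : ∀ i, ∃ P ∈ blocks, i ∈ P

/-- (Unordered) set partitions of an `n`-element set. The order is that of Mathlib: `X ≤ Y` means
that each block of `X` is contained in a block of `Y`, so coarser partitions are larger. -/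
abbrev SetPartition (n : ℕ) : Type := Finpartition (Finset.univ : Finset (Fin n))

namespace OrderedSetPartition

variable {n : ℕ}

/-- The list `(P₁ ∩ Q₁, …, P₁ ∩ Q_s, P₂ ∩ Q₁, …, P_r ∩ Q_s)` with the empty intersections
omitted. -/
def interList (P Q : List (Finset (Fin n))) : List (Finset (Fin n)) :=
  (P.flatMap fun p => Q.map fun q => p ∩ q).filter fun s => decide s.Nonempty

lemma mem_interList {P Q : List (Finset (Fin n))} {s : Finset (Fin n)} :
    s ∈ interList P Q ↔ (∃ p ∈ P, ∃ q ∈ Q, p ∩ q = s) ∧ s.Nonempty := by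
  simp [interList]

lemma filter_flatMap_filter (L : List (Finset (Fin n)))
    (F : Finset (Fin n) → List (Finset (Fin n))) (hF : ∀ s ∈ F ∅, s = ∅) :
    ((L.filter fun s => decide s.Nonempty).flatMap F).filter (fun s => decide s.Nonempty) =
      (L.flatMap F).filter fun s => decide s.Nonempty := by
  induction L with
  | nil => rfl
  | cons a L ih =>
    by_cases ha : a.Nonempty
    · simp [ha, ih]
    · have ha' : a = ∅ := Finset.not_nonempty_iff_eq_empty.1 ha
      subst ha'
      have h0 : (F ∅).filter (fun s => decide s.Nonempty) = [] := by
        rw [List.filter_eq_nil_iff]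
        intro s hs
        simp [hF s hs]
      simp [ih, h0]

lemma filter_map_inter_filter (p : Finset (Fin n)) (L : List (Finset (Fin n))) :
    ((L.filter fun s => decide s.Nonempty).map fun q => p ∩ q).filter
        (fun s => decide s.Nonempty) =
      (L.map fun q => p ∩ q).filter fun s => decide s.Nonempty := by
  have h := filter_flatMap_filter L (fun q => [p ∩ q]) (by simp)
  simpa [List.flatMap_singleton', ← List.map_eq_flatMap] using h

lemma interList_assoc (P Q R : List (Finset (Fin n))) :
    interList (interList P Q) R = interList P (interList Q R) := by
  have h1 : interList (interList P Q) R =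
      ((P.flatMap fun p => Q.map fun q => p ∩ q).flatMap
        fun p => R.map fun q => p ∩ q).filter fun s => decide s.Nonempty :=
    filter_flatMap_filter _ _ (by simp)
  have h2 : interList P (interList Q R) =
      (P.flatMap fun p => (Q.flatMap fun q => R.map fun r => q ∩ r).map
        fun s => p ∩ s).filter fun s => decide s.Nonempty := by
    unfold interList
    rw [List.filter_flatMap, List.filter_flatMap (l := P)]
    exact congrArg (fun F => List.flatMap F P) (funext fun p => filter_map_inter_filter p _)
  rw [h1, h2, List.flatMap_assoc]
  congr 2
  funext p
  simp [List.flatMap_map, List.map_flatMap, Function.comp_def, Finset.inter_assoc]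

/-- The product of ordered set partitions. -/
instance : Mul (OrderedSetPartition n) where
  mul π τ :=
    { blocks := interList π.blocks τ.blocks
      nonempty := fun s hs => (mem_interList.1 hs).2
      disjoint := by
        refine List.Pairwise.filter _ ?_
        rw [List.pairwise_flatMap]
        refine ⟨fun p _ => ?_, ?_⟩
        · rw [List.pairwise_map]
          exact τ.disjoint.imp fun h => h.mono Finset.inter_subset_right Finset.inter_subset_right
        · refine π.disjoint.imp fun h => ?_
          simp only [List.mem_map]
          rintro _ ⟨q, _, rfl⟩ _ ⟨q', _, rfl⟩
          exact h.mono Finset.inter_subset_left Finset.inter_subset_left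
      cover := fun i => by
        obtain ⟨p, hp, hip⟩ := π.cover i
        obtain ⟨q, hq, hiq⟩ := τ.cover i
        have hi : i ∈ p ∩ q := Finset.mem_inter.2 ⟨hip, hiq⟩
        exact ⟨p ∩ q, mem_interList.2 ⟨⟨p, hp, q, hq, rfl⟩, i, hi⟩, hi⟩ }

/-- The identity is the ordered set partition with one block (with no block if `n = 0`). -/
instance : One (OrderedSetPartition n) where
  one :=
    { blocks := [Finset.univ].filter fun s => decide s.Nonempty
      nonempty := by simp
      disjoint := List.Pairwise.filter _ (List.pairwise_singleton _ _)
      cover := fun i => ⟨Finset.univ, by simpa using ⟨i, Finset.mem_univ i⟩, Finset.mem_univ i⟩ }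

lemma blocks_mul (π τ : OrderedSetPartition n) :
    (π * τ).blocks = interList π.blocks τ.blocks := rfl

lemma blocks_one :
    (1 : OrderedSetPartition n).blocks = [Finset.univ].filter fun s => decide s.Nonempty := rfl

lemma filter_blocks (π : OrderedSetPartition n) :
    (π.blocks.filter fun s => decide s.Nonempty) = π.blocks :=
  List.filter_eq_self.2 fun s hs => by simpa using π.nonempty s hs

/-- The monoid `Σ_n` of ordered set partitions. -/
instance : Monoid (OrderedSetPartition n) where
  mul_assoc π τ ρ := OrderedSetPartition.ext (interList_assoc _ _ _)
  one_mul π := by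
    apply OrderedSetPartition.ext
    rw [blocks_mul, blocks_one, interList, filter_flatMap_filter _ _ (by simp)]
    simpa using π.filter_blocks
  mul_one π := by
    apply OrderedSetPartition.ext
    rw [blocks_mul, blocks_one, interList, List.filter_flatMap]
    simp only [filter_map_inter_filter]
    rw [← List.filter_flatMap]
    simpa using π.filter_blocks

lemma eq_of_mem (π : OrderedSetPartition n) {P Q : Finset (Fin n)} (hP : P ∈ π.blocks)
    (hQ : Q ∈ π.blocks) {i : Fin n} (hiP : i ∈ P) (hiQ : i ∈ Q) : P = Q := by
  by_contra hne
  exact Finset.disjoint_left.1 (π.disjoint.forall hP hQ hne) hiP hiQ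

/-- The underlying set partition `σ(π)` of an ordered set partition `π`. -/
def shape (π : OrderedSetPartition n) : SetPartition n where
  parts := π.blocks.toFinset
  supIndep := by
    rw [Finset.supIndep_iff_pairwiseDisjoint]
    intro P hP Q hQ hne
    exact π.disjoint.forall (by simpa using hP) (by simpa using hQ) hne
  sup_parts := by
    ext i
    simpa [Finset.mem_sup] using π.cover i
  bot_notMem := fun h => by
    have := π.nonempty _ (List.mem_toFinset.1 h)
    simp at this

lemma mem_parts_shape {π : OrderedSetPartition n} {P : Finset (Fin n)} :
    P ∈ π.shape.parts ↔ P ∈ π.blocks := List.mem_toFinset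

lemma shape_mul (π τ : OrderedSetPartition n) : (π * τ).shape = π.shape ⊓ τ.shape := by
  ext s
  rw [mem_parts_shape, blocks_mul, mem_interList, Finpartition.parts_inf, Finset.mem_erase]
  simp only [Finset.mem_image, Finset.mem_product, Prod.exists, mem_parts_shape,
    Finset.bot_eq_empty, Finset.nonempty_iff_ne_empty, Finset.inf_eq_inter]
  grind

lemma le_shape_one (X : SetPartition n) : X ≤ (1 : OrderedSetPartition n).shape := by
  intro P hP
  refine ⟨Finset.univ, ?_, Finset.subset_univ P⟩
  rw [mem_parts_shape, blocks_one]
  obtain ⟨i, _⟩ := X.nonempty_of_mem_parts hP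
  simpa using ⟨i, Finset.mem_univ i⟩

instance : Finite (OrderedSetPartition n) := by
  have hnd (π : OrderedSetPartition n) : π.blocks.Nodup :=
    π.disjoint.imp_of_mem fun {P Q} hP _ h => by
      rintro rfl
      exact (π.nonempty P hP).ne_empty (disjoint_self.1 h)
  refine Finite.of_injective
    (fun π : OrderedSetPartition n =>
      (⟨π.blocks, hnd π⟩ : {l : List (Finset (Fin n)) // l.Nodup})) fun π τ h => ?_
  exact OrderedSetPartition.ext (congrArg Subtype.val h)

end OrderedSetPartition

/-! ### Hsiao's monoid -/

section Hsiao

variable {n : ℕ}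

/-- The subgroup `G_X` of `G^n` of those `g` with `g_i = g_j` whenever `i` and `j` are in the same
block of `X`. -/
def blockSubgroup (G : Type v) [Group G] (X : SetPartition n) : Subgroup (Fin n → G) where
  carrier := {g | ∀ P ∈ X.parts, ∀ i ∈ P, ∀ j ∈ P, g i = g j}
  mul_mem' := fun {a b} ha hb P hP i hi j hj => by
    simp [ha P hP i hi j hj, hb P hP i hi j hj]
  one_mem' := fun _ _ _ _ _ _ => rfl
  inv_mem' := fun {a} ha P hP i hi j hj => by simp [ha P hP i hi j hj]

/-- If `X ≤ Y` then `G_Y ≤ G_X`. -/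
lemma blockSubgroup_anti {G : Type v} [Group G] {X Y : SetPartition n} (h : X ≤ Y) :
    blockSubgroup G Y ≤ blockSubgroup G X := fun _ hg P hP i hi j hj => by
  obtain ⟨Q, hQ, hPQ⟩ := h hP
  exact hg Q hQ i (hPQ hi) j (hPQ hj)

/-- Hsiao's monoid `Σ_n^G` of ordered `G`-partitions: the submonoid of `Σ_n × G^n` of all `(π, g)`
such that `g_i = g_j` whenever `i` and `j` are in the same block of `σ(π)`. -/
def hsiaoMonoid (n : ℕ) (G : Type v) [Group G] :
    Submonoid (OrderedSetPartition n × (Fin n → G)) where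
  carrier := {m | m.2 ∈ blockSubgroup G m.1.shape}
  mul_mem' := fun {a b} ha hb => by
    change a.2 * b.2 ∈ blockSubgroup G (a.1 * b.1).shape
    rw [OrderedSetPartition.shape_mul]
    exact mul_mem (blockSubgroup_anti inf_le_left ha) (blockSubgroup_anti inf_le_right hb)
  one_mem' := one_mem (blockSubgroup G (1 : OrderedSetPartition n).shape)

lemma mem_hsiaoMonoid {G : Type v} [Group G] {m : OrderedSetPartition n × (Fin n → G)} :
    m ∈ hsiaoMonoid n G ↔ m.2 ∈ blockSubgroup G m.1.shape := Iff.rfl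

/-- The homomorphism `G_X → G`, `g ↦ g_P`, where `g_P` is the common value of the `g_i` with
`i ∈ P`. -/
def blockValue {G : Type v} [Group G] (X : SetPartition n) (P : X.parts) :
    blockSubgroup G X →* G :=
  (Pi.evalMonoidHom (fun _ : Fin n => G)
    (P.1.min' (X.nonempty_of_mem_parts P.2))).comp (blockSubgroup G X).subtype

lemma blockValue_eq {G : Type v} [Group G] (X : SetPartition n) (P : X.parts)
    (g : blockSubgroup G X) {i : Fin n} (hi : i ∈ P.1) : blockValue X P g = g.1 i :=
  g.2 P.1 P.2 _ (Finset.min'_mem _ _) i hi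

variable {K : Type u} [Field K] {G : Type v} [Group G]

/-- For a family `f` of characters of `G` indexed by the blocks of `X`, the character
`g ↦ ∏_{P ∈ X} f(P)(g_P)` of `G_X`, by which `G_X` acts on the (one-dimensional) tensor product
over `P ∈ X` of the `KG`-modules with characters `f(P)`. -/
def blockCharacter (X : SetPartition n) (f : X.parts → (G →* Kˣ)) :
    blockSubgroup G X →* Kˣ :=
  ∏ P : X.parts, (f P).comp (blockValue X P)

open scoped Classical in
/-- The inflation to `Σ_n^G` of the character `blockCharacter X f` of `G_X`: an element `(π, g)`
acts as `g ∈ G_{σ(π)} ≤ G_X` if `X ≤ σ(π)`, and as zero otherwise. -/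
noncomputable def inflatedCharacter (X : SetPartition n) (f : X.parts → (G →* Kˣ)) :
    hsiaoMonoid n G →* K where
  toFun m :=
    if h : X ≤ m.1.1.shape then
      (blockCharacter X f ⟨m.1.2, blockSubgroup_anti h (mem_hsiaoMonoid.1 m.2)⟩ : K)
    else 0
  map_one' := by
    refine (dif_pos (OrderedSetPartition.le_shape_one X)).trans ?_
    exact congrArg Units.val (map_one (blockCharacter X f))
  map_mul' a b := by
    have key : X ≤ (a * b).1.1.shape ↔ X ≤ a.1.1.shape ∧ X ≤ b.1.1.shape := by
      change X ≤ (a.1.1 * b.1.1).shape ↔ _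
      rw [OrderedSetPartition.shape_mul, le_inf_iff]
    by_cases ha : X ≤ a.1.1.shape
    · by_cases hb : X ≤ b.1.1.shape
      · rw [dif_pos (key.2 ⟨ha, hb⟩), dif_pos ha, dif_pos hb, ← Units.val_mul, ← map_mul]
        rfl
      · rw [dif_neg hb, dif_neg fun h => hb (key.1 h).2, mul_zero]
    · rw [dif_neg ha, dif_neg fun h => ha (key.1 h).1, zero_mul]

/-- The underlying space `K` of the simple `KΣ_n^G`-module `(X, f)`. -/
def HsiaoSimple (X : SetPartition n) (_f : X.parts → (G →* Kˣ)) : Type u := K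

noncomputable instance (X : SetPartition n) (f : X.parts → (G →* Kˣ)) :
    AddCommGroup (HsiaoSimple X f) := inferInstanceAs (AddCommGroup K)

/-- The left `KΣ_n^G`-module structure of `(X, f)`: the element `m ∈ Σ_n^G` acts on `K` as
multiplication by `inflatedCharacter X f m`. -/
noncomputable instance (X : SetPartition n) (f : X.parts → (G →* Kˣ)) :
    Module (MonoidAlgebra K (hsiaoMonoid n G)) (HsiaoSimple X f) :=
  Module.compHom K
    (MonoidAlgebra.lift K K (hsiaoMonoid n G) (inflatedCharacter X f)).toRingHom

instance (X : SetPartition n) (f : X.parts → (G →* Kˣ)) :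
    IsSimpleModule (MonoidAlgebra K (hsiaoMonoid n G)) (HsiaoSimple X f) := by
  have hs : Function.Surjective
      (MonoidAlgebra.lift K K (hsiaoMonoid n G) (inflatedCharacter X f)).toRingHom := fun k =>
    ⟨algebraMap K _ k, AlgHom.commutes
      (MonoidAlgebra.lift K K (hsiaoMonoid n G) (inflatedCharacter X f)) k⟩
  refine isSimpleModule_iff_toSpanSingleton_surjective.2 ⟨inferInstanceAs (Nontrivial K), ?_⟩
  intro x hx y
  obtain ⟨r, hr⟩ := hs (id (α := K) y / id (α := K) x)
  exact ⟨r, (congrArg (fun t : K => t * id (α := K) x) hr).trans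
    (div_mul_cancel₀ (id (α := K) y) hx)⟩

/-- The monoid algebra of a finite monoid lies, up to bijection, in the universe of `K`. Hence
modules over it in that universe have `Ext`-groups in Mathlib's sense. -/
instance [Finite G] : Small.{u} (MonoidAlgebra K (hsiaoMonoid n G)) :=
  small_of_injective (β := hsiaoMonoid n G → K) (f := fun a => a.coeff)
    fun _ _ h => MonoidAlgebra.coeff_injective (DFunLike.coe_injective h)

/-- The simple `KΣ_n^G`-module `(X, f)` as an object of the category of `KΣ_n^G`-modules. -/
noncomputable abbrev hsiaoSimple (X : SetPartition n) (f : X.parts → (G →* Kˣ)) :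
    ModuleCat.{u} (MonoidAlgebra K (hsiaoMonoid n G)) :=
  ModuleCat.of _ (HsiaoSimple X f)

end Hsiao

/-! ### Splitting fields -/

/-- The extension of scalars of a representation along a field extension. -/
noncomputable def extendScalars {K : Type u} [Field K] {G : Type v} [Group G]
    {V : Type u} [AddCommGroup V] [Module K V] (ρ : Representation K G V)
    (L : Type u) [Field L] [Algebra K L] : Representation L G (TensorProduct K L V) where
  toFun g := (ρ g).baseChange L
  map_one' := by rw [map_one, Module.End.one_eq_id, LinearMap.baseChange_id]; rfl
  map_mul' g h := by rw [map_mul, Module.End.mul_eq_comp, LinearMap.baseChange_comp]; rfl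

/-- `K` is a splitting field for the finite group `G`: each simple `KG`-module remains simple after
extending scalars to the algebraic closure of `K`. -/
def IsSplittingFieldFor (K : Type u) [Field K] (G : Type v) [Group G] : Prop :=
  ∀ (V : Type u) [AddCommGroup V] [Module K V] (ρ : Representation K G V),
    ρ.IsIrreducible → (extendScalars ρ (AlgebraicClosure K)).IsIrreducible

namespace BlockList

/-! ### Acyclicity of the complex of ordered partitions under merging of adjacent blocks -/

section Coboundary

set_option linter.unusedSectionVars false

variable {K : Type*} [CommRing K] {α : Type*} [DecidableEq α]

/-- The alternating sum of the values of `c` at the lists obtained from a given one by merging two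
adjacent blocks. -/
def coboundary : List (Finset α) → (List (Finset α) → K) → K
  | [], _ => 0
  | [_], _ => 0
  | P :: Q :: L, c => c ((P ∪ Q) :: L) - coboundary (Q :: L) fun M => c (P :: M)

/-- The alternating sum of the values of `c` at the lists obtained from a given one by inserting
the block `x`. -/
def insertSum (x : Finset α) : List (Finset α) → (List (Finset α) → K) → K
  | [], c => c [x]
  | Q :: L, c => c (x :: Q :: L) - insertSum x L fun M => c (Q :: M)

/-- The homotopy that splits off `x` from the block containing it, and moves it to the right. -/
def splitSum (x : Finset α) : List (Finset α) → (List (Finset α) → K) → K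
  | [], _ => 0
  | P :: L, c =>
    if x ⊆ P then if P = x then 0 else insertSum x L fun M => c ((P \ x) :: M)
    else - splitSum x L fun M => c (P :: M)

/-- Merging `P` with the first block of a list. -/
def mergeHead (P : Finset α) (c : List (Finset α) → K) : List (Finset α) → K
  | [] => 0
  | Q :: L => c ((P ∪ Q) :: L)

lemma coboundary_cons (P : Finset α) (L : List (Finset α)) (c : List (Finset α) → K) :
    coboundary (P :: L) c = mergeHead P c L - coboundary L fun M => c (P :: M) := by
  cases L <;> simp [coboundary, mergeHead]

lemma coboundary_sub (L : List (Finset α)) (c c' : List (Finset α) → K) :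
    (coboundary L fun M => c M - c' M) = coboundary L c - coboundary L c' := by
  induction L generalizing c c' with
  | nil => simp [coboundary]
  | cons P L ih => cases L <;> simp [coboundary, ih]; ring

lemma coboundary_zero (L : List (Finset α)) :
    (coboundary L fun _ => (0 : K)) = 0 := by
  induction L with
  | nil => simp [coboundary]
  | cons P L ih => cases L <;> simp_all [coboundary]

lemma coboundary_neg (L : List (Finset α)) (c : List (Finset α) → K) :
    (coboundary L fun M => - c M) = - coboundary L c := by
  simpa [coboundary_zero] using coboundary_sub L (fun _ => 0) c

lemma insertSum_sub (x : Finset α) (L : List (Finset α)) (c c' : List (Finset α) → K) :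
    (insertSum x L fun M => c M - c' M) = insertSum x L c - insertSum x L c' := by
  induction L generalizing c c' with
  | nil => simp [insertSum]
  | cons P L ih => simp [insertSum, ih]; ring

lemma insertSum_zero (x : Finset α) (L : List (Finset α)) :
    (insertSum x L fun _ => (0 : K)) = 0 := by
  induction L with
  | nil => simp [insertSum]
  | cons P L ih => simp_all [insertSum]

lemma insertSum_neg (x : Finset α) (L : List (Finset α)) (c : List (Finset α) → K) :
    (insertSum x L fun M => - c M) = - insertSum x L c := by
  simpa [insertSum_zero] using insertSum_sub x L (fun _ => 0) c

lemma splitSum_sub (x : Finset α) (L : List (Finset α)) (c c' : List (Finset α) → K) :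
    (splitSum x L fun M => c M - c' M) = splitSum x L c - splitSum x L c' := by
  induction L generalizing c c' with
  | nil => simp [splitSum]
  | cons P L ih =>
    simp only [splitSum, ih, insertSum_sub]
    split_ifs <;> ring

lemma coboundary_coboundary (L : List (Finset α)) (c : List (Finset α) → K) :
    (coboundary L fun M => coboundary M c) = 0 := by
  induction L generalizing c with
  | nil => simp [coboundary]
  | cons P L ih =>
    cases L with
    | nil => simp [coboundary]
    | cons Q L =>
      cases L with
      | nil => simp [coboundary]
      | cons R L =>
        have h1 := ih fun M => c (P :: M)
        rw [coboundary_cons]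
        simp only [mergeHead, coboundary_cons P, coboundary_sub, h1, sub_zero]
        rw [coboundary_cons Q, coboundary_cons (P ∪ Q)]
        simp only [mergeHead]
        rw [Finset.union_assoc]
        ring

/-- Merging an inserted `x` with its left neighbour and merging it with its right neighbour after
insertion one place earlier give the same list with opposite signs. The surviving merges do not
involve `x`. -/
lemma insertSum_coboundary (x : Finset α) (L : List (Finset α)) (c : List (Finset α) → K) :
    (insertSum x L fun M => coboundary M c) = - coboundary L fun M => insertSum x M c := by
  induction L generalizing c with
  | nil => simp [coboundary, insertSum]
  | cons P L ih =>
    have h1 := ih fun M => c (P :: M)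
    cases L with
    | nil => simp [coboundary, insertSum, Finset.union_comm]
    | cons Q L =>
      have h2 : ∀ M, (fun M => insertSum x (P :: M) c) M =
        c (x :: P :: M) - insertSum x M fun M => c (P :: M) := fun M => rfl
      rw [coboundary_cons P (Q :: L)]
      simp only [h2, coboundary_sub]
      rw [insertSum]
      simp only [coboundary_cons P, insertSum_sub, h1]
      simp only [coboundary_cons x, mergeHead, insertSum]
      rw [coboundary_cons P]
      simp only [mergeHead, Finset.union_comm x P]
      ring

/-- All blocks are nonempty and pairwise disjoint. -/
def IsDisjoint (L : List (Finset α)) : Prop :=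
  L.Pairwise Disjoint ∧ ∀ P ∈ L, P.Nonempty

lemma IsDisjoint.tail {P : Finset α} {L : List (Finset α)} (h : IsDisjoint (P :: L)) :
    IsDisjoint L :=
  ⟨h.1.of_cons, fun Q hQ => h.2 Q (List.mem_cons_of_mem _ hQ)⟩

/-- Correction term of the homotopy: it appears at the lists that begin with `x`. -/
def headTerm (x : Finset α) (c : List (Finset α) → K) : List (Finset α) → K
  | [] => 0
  | P :: L => if P = x then insertSum x L c else 0

/-- The homotopy formula. Splitting `x` off and merging it back at once returns `c L`; the other
terms cancel in pairs. The exception is a list `x :: L`: no block can be split there, and merging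
`x` with its right neighbour and splitting again yields all reinsertions of `x` into `L` except the
first one. Hence the correction `headTerm`. -/
lemma splitSum_coboundary (x : Finset α) (hx : x.Nonempty) (L : List (Finset α))
    (hL : IsDisjoint L) (hxL : ∃ P ∈ L, x ⊆ P) (c : List (Finset α) → K) :
    (coboundary L fun M => splitSum x M c) + (splitSum x L fun M => coboundary M c) =
      c L - headTerm x c L := by
  induction L generalizing c with
  | nil => simp at hxL
  | cons P L ih =>
    have hd (Q) (hQ : Q ∈ L) : Disjoint P Q := (List.pairwise_cons.1 hL.1).1 Q hQ
    have hne (Q) (hQ : Q ∈ L) : Q.Nonempty := hL.2 Q (by simp [hQ])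
    by_cases hxP : x ⊆ P
    · by_cases hPx : P = x
      · subst hPx
        cases L with
        | nil => simp [coboundary, splitSum, headTerm, insertSum]
        | cons Q L =>
          have hd := hd Q (by simp)
          have hQ := hne Q (by simp)
          have h1 : P ∪ Q ≠ P := by
            intro h
            have : Q ⊆ P := Finset.union_eq_left.1 h
            exact hQ.ne_empty (Finset.disjoint_self_iff_empty _ |>.1 (hd.mono_left this))
          have hsd : (P ∪ Q) \ P = Q := by
            rw [Finset.union_sdiff_left]; exact Finset.sdiff_eq_self_of_disjoint hd.symm
          simp [coboundary, splitSum, headTerm, insertSum, h1, hsd, coboundary_zero]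
      · have h0 : ∀ M, splitSum x (P :: M) c = insertSum x M fun M => c ((P \ x) :: M) :=
          fun M => by simp [splitSum, hxP, hPx]
        rw [coboundary_cons, splitSum, if_pos hxP, if_neg hPx]
        simp only [h0, coboundary_cons (P \ x), insertSum_sub, insertSum_coboundary, headTerm,
          if_neg hPx]
        cases L with
        | nil => simp [mergeHead, insertSum, Finset.sdiff_union_of_subset hxP]
        | cons Q L =>
          have hxQ : Disjoint x Q := (hd Q (by simp)).mono_left hxP
          have hQ := hne Q (by simp)
          have h1 : P ∪ Q ≠ x := by
            intro h
            rw [← h] at hxQ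
            exact hQ.ne_empty (Finset.disjoint_self_iff_empty _ |>.1
              (hxQ.mono_left Finset.subset_union_right))
          have h2 : (P ∪ Q) \ x = P \ x ∪ Q := by
            rw [Finset.union_sdiff_distrib, Finset.sdiff_eq_self_of_disjoint hxQ.symm]
          simp [mergeHead, splitSum, insertSum, hxP.trans Finset.subset_union_left, h1, h2,
            Finset.sdiff_union_of_subset hxP]
    · have hxL' : ∃ P ∈ L, x ⊆ P := by
        obtain ⟨Q, hQ, hxQ⟩ := hxL
        rcases List.mem_cons.1 hQ with rfl | hQ
        · exact absurd hxQ hxP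
        · exact ⟨Q, hQ, hxQ⟩
      have hPx : P ≠ x := fun h => hxP (h ▸ subset_rfl)
      have ih := ih hL.tail hxL' fun M => c (P :: M)
      have h0 : ∀ M, splitSum x (P :: M) c = - splitSum x M fun M => c (P :: M) :=
        fun M => by simp [splitSum, hxP]
      rw [coboundary_cons, splitSum, if_neg hxP]
      simp only [h0, coboundary_cons P, splitSum_sub, coboundary_neg, headTerm, if_neg hPx,
        sub_zero]
      -- Compared with the tail, the only new terms merge `P` with the first block of `L`. They
      -- matter only if that block is `x`, and then they cancel the correction term of the tail.
      suffices h : mergeHead P (fun M => splitSum x M c) L - splitSum x L (mergeHead P c) =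
          headTerm x (fun M => c (P :: M)) L by
        linear_combination ih + h
      cases L with
      | nil => simp at hxL'
      | cons Q L =>
        have hPQ := hd Q (by simp)
        have hPne : P.Nonempty := hL.2 P (by simp)
        by_cases hxQ : x ⊆ Q
        · have h2 : (P ∪ Q) \ x = P ∪ Q \ x := by
            rw [Finset.union_sdiff_distrib,
              Finset.sdiff_eq_self_of_disjoint (hPQ.mono_right hxQ)]
          have h1 : P ∪ Q ≠ x := by
            intro h
            have : P ⊆ Q := (h ▸ Finset.subset_union_left : P ⊆ x).trans hxQ
            exact hPne.ne_empty (Finset.disjoint_self_iff_empty _ |>.1 (hPQ.mono_right this))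
          by_cases hQx : Q = x
          · subst hQx
            rw [Finset.sdiff_self, Finset.union_empty] at h2
            have h1 : ¬ P ⊆ Q := fun h => h1 (Finset.union_eq_right.2 h)
            simp [mergeHead, splitSum, headTerm, h1, h2]
          · simp [mergeHead, splitSum, headTerm, hxQ.trans Finset.subset_union_right, h1, h2, hQx,
              hxQ]
        · have hxPQ : ¬ x ⊆ P ∪ Q := by
            intro h
            obtain ⟨R, hR, hxR⟩ := hxL'
            have hRL : R ∈ L := by
              rcases List.mem_cons.1 hR with rfl | hR
              · exact absurd hxR hxQ
              · exact hR
            have h3 : Disjoint (P ∪ Q) R := by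
              rw [Finset.disjoint_union_left]
              exact ⟨hd R hR, (List.pairwise_cons.1 hL.tail.1).1 R hRL⟩
            exact hx.ne_empty (Finset.disjoint_self_iff_empty _ |>.1 (h3.mono h hxR))
          have hQx : Q ≠ x := fun h => hxQ (h ▸ subset_rfl)
          simp [mergeHead, splitSum, headTerm, hxPQ, hxQ, hQx]

lemma insertSum_eq_zero {x : Finset α} {L : List (Finset α)} {c : List (Finset α) → K}
    (h : ∀ M, M.Perm (x :: L) → c M = 0) : insertSum x L c = 0 := by
  induction L generalizing c with
  | nil => exact h _ (List.Perm.refl _)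
  | cons Q L ih =>
    rw [insertSum, h _ (List.Perm.refl _), ih, sub_zero]
    exact fun M hM => h _ ((hM.cons Q).trans (List.Perm.swap _ _ _))

lemma splitSum_eq_zero {x : Finset α} {L : List (Finset α)} {c : List (Finset α) → K}
    (h : ∀ P N M, L.Perm (P :: N) → x ⊆ P → P ≠ x → M.Perm (x :: (P \ x) :: N) → c M = 0) :
    splitSum x L c = 0 := by
  induction L generalizing c with
  | nil => rfl
  | cons Q L ih =>
    rw [splitSum]
    split_ifs with h1 h2
    · rfl
    · exact insertSum_eq_zero fun M hM =>
        h Q L _ (List.Perm.refl _) h1 h2 ((hM.cons _).trans (List.Perm.swap _ _ _))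
    · rw [ih, neg_zero]
      intro P N M hL hP hPx hM
      refine h P (Q :: N) _ ((hL.cons Q).trans (List.Perm.swap _ _ _)) hP hPx ?_
      exact (hM.cons Q).trans
        ((List.Perm.swap _ _ _).trans ((List.Perm.swap _ _ _).cons x))

lemma coboundary_eq_zero {L : List (Finset α)} {c : List (Finset α) → K}
    (h : ∀ L₁ P Q L₂, L = L₁ ++ P :: Q :: L₂ → c (L₁ ++ (P ∪ Q) :: L₂) = 0) :
    coboundary L c = 0 := by
  induction L generalizing c with
  | nil => rfl
  | cons P L ih =>
    rw [coboundary_cons, ih, sub_zero]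
    · cases L with
      | nil => rfl
      | cons Q L => exact h [] P Q L rfl
    · rintro L₁ P' Q L₂ rfl
      exact h (P :: L₁) P' Q L₂ rfl

/-- The lists of nonempty pairwise disjoint blocks that are unions of members of `A` and whose
union is that of `A`. -/
structure IsOrderedPartition (A L : List (Finset α)) : Prop extends IsDisjoint L where
  exists_le : ∀ x ∈ A, ∃ P ∈ L, x ⊆ P
  cover : ∀ P ∈ L, ∀ i ∈ P, ∃ x ∈ A, i ∈ x

lemma IsOrderedPartition.perm {A L M : List (Finset α)} (h : IsOrderedPartition A L)
    (hLM : L.Perm M) : IsOrderedPartition A M where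
  left := (hLM.pairwise_iff fun h => h.symm).1 h.left
  right P hP := h.right P (hLM.mem_iff.2 hP)
  exists_le x hx := by
    obtain ⟨P, hP, hxP⟩ := h.exists_le x hx
    exact ⟨P, hLM.mem_iff.1 hP, hxP⟩
  cover P hP := h.cover P (hLM.mem_iff.2 hP)

lemma IsOrderedPartition.merge {A L₁ L₂ : List (Finset α)} {P Q : Finset α}
    (h : IsOrderedPartition A (L₁ ++ P :: Q :: L₂)) :
    IsOrderedPartition A (L₁ ++ (P ∪ Q) :: L₂) := by
  have hp : (L₁ ++ P :: Q :: L₂).Perm (P :: Q :: (L₁ ++ L₂)) :=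
    List.perm_middle.trans (List.perm_middle.cons P)
  have h := h.perm hp
  refine IsOrderedPartition.perm ?_ List.perm_middle.symm
  have h1 := List.pairwise_cons.1 h.left
  have h2 := List.pairwise_cons.1 h1.2
  refine ⟨⟨List.pairwise_cons.2 ⟨fun R hR => ?_, h2.2⟩, ?_⟩, ?_, ?_⟩
  · exact Finset.disjoint_union_left.2 ⟨h1.1 R (List.mem_cons_of_mem _ hR), h2.1 R hR⟩
  · intro R hR
    rcases List.mem_cons.1 hR with rfl | hR
    · exact (h.right P (by simp)).mono Finset.subset_union_left
    · exact h.right R (by simp [hR])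
  · intro x hx
    obtain ⟨R, hR, hxR⟩ := h.exists_le x hx
    simp only [List.mem_cons] at hR
    rcases hR with rfl | rfl | hR
    · exact ⟨_, List.mem_cons_self, hxR.trans Finset.subset_union_left⟩
    · exact ⟨_, List.mem_cons_self, hxR.trans Finset.subset_union_right⟩
    · exact ⟨R, List.mem_cons_of_mem _ hR, hxR⟩
  · intro R hR i hi
    rcases List.mem_cons.1 hR with rfl | hR
    · rcases Finset.mem_union.1 hi with hi | hi
      · exact h.cover P (by simp) i hi
      · exact h.cover Q (by simp) i hi
    · exact h.cover R (by simp [hR]) i hi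

lemma IsOrderedPartition.split {A N : List (Finset α)} {x P : Finset α}
    (h : IsOrderedPartition A (P :: N)) (hA : IsDisjoint A) (hxA : x ∈ A) (hx : x ⊆ P)
    (hP : P ≠ x) : IsOrderedPartition A (x :: (P \ x) :: N) := by
  have h1 := List.pairwise_cons.1 h.left
  refine ⟨⟨List.pairwise_cons.2 ⟨fun R hR => ?_, List.pairwise_cons.2 ⟨fun R hR => ?_, h1.2⟩⟩, ?_⟩,
    ?_, ?_⟩
  · rcases List.mem_cons.1 hR with rfl | hR
    · exact Finset.disjoint_sdiff
    · exact (h1.1 R hR).mono_left hx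
  · exact (h1.1 R hR).mono_left Finset.sdiff_subset
  · intro R hR
    simp only [List.mem_cons] at hR
    rcases hR with rfl | rfl | hR
    · exact hA.2 R hxA
    · exact Finset.sdiff_nonempty.2 fun h' => hP (h'.antisymm hx)
    · exact h.right R (by simp [hR])
  · intro y hy
    by_cases hyx : y = x
    · exact ⟨x, by simp, hyx ▸ subset_rfl⟩
    obtain ⟨R, hR, hyR⟩ := h.exists_le y hy
    rcases List.mem_cons.1 hR with rfl | hR
    · exact ⟨R \ x, by simp, Finset.subset_sdiff.2 ⟨hyR, hA.1.forall hy hxA hyx⟩⟩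
    · exact ⟨R, by simp [hR], hyR⟩
  · intro R hR i hi
    simp only [List.mem_cons] at hR
    rcases hR with rfl | rfl | hR
    · exact ⟨R, hxA, hi⟩
    · exact h.cover P (by simp) i (Finset.sdiff_subset hi)
    · exact h.cover R (by simp [hR]) i hi

lemma IsOrderedPartition.cons {A L : List (Finset α)} {x : Finset α}
    (hA : IsDisjoint (x :: A)) (h : IsOrderedPartition A L) :
    IsOrderedPartition (x :: A) (x :: L) where
  left := by
    refine List.pairwise_cons.2 ⟨fun P hP => ?_, h.left⟩
    rw [Finset.disjoint_right]
    intro i hi hix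
    obtain ⟨y, hy, hiy⟩ := h.cover P hP i hi
    exact Finset.disjoint_left.1 ((List.pairwise_cons.1 hA.1).1 y hy) hix hiy
  right P hP := by
    rcases List.mem_cons.1 hP with rfl | hP
    · exact hA.2 P (by simp)
    · exact h.right P hP
  exists_le y hy := by
    rcases List.mem_cons.1 hy with rfl | hy
    · exact ⟨y, by simp, subset_rfl⟩
    · obtain ⟨P, hP, h⟩ := h.exists_le y hy
      exact ⟨P, by simp [hP], h⟩
  cover P hP i hi := by
    rcases List.mem_cons.1 hP with rfl | hP
    · exact ⟨P, by simp, hi⟩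
    · obtain ⟨y, hy, h⟩ := h.cover P hP i hi
      exact ⟨y, by simp [hy], h⟩

lemma IsOrderedPartition.of_cons {A L : List (Finset α)} {x : Finset α}
    (hA : IsDisjoint (x :: A)) (h : IsOrderedPartition (x :: A) (x :: L)) :
    IsOrderedPartition A L where
  toAnd := IsDisjoint.tail h.toAnd
  exists_le y hy := by
    obtain ⟨P, hP, hyP⟩ := h.exists_le y (by simp [hy])
    rcases List.mem_cons.1 hP with rfl | hP
    · exact absurd (Finset.disjoint_self_iff_empty _ |>.1
        (((List.pairwise_cons.1 hA.1).1 y hy).mono_left hyP)) (hA.2 y (by simp [hy])).ne_empty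
    · exact ⟨P, hP, hyP⟩
  cover P hP i hi := by
    obtain ⟨y, hy, hiy⟩ := h.cover P (by simp [hP]) i hi
    rcases List.mem_cons.1 hy with rfl | hy
    · exact absurd hi (Finset.disjoint_left.1 ((List.pairwise_cons.1 h.left).1 P hP) hiy)
    · exact ⟨y, hy, hiy⟩

/-- The alternating sum of the values of `c` at the permutations of a list. -/
def orderSum : List (Finset α) → (List (Finset α) → K) → K
  | [], c => c []
  | x :: A, c => orderSum A fun M => insertSum x M c

lemma orderSum_neg (A : List (Finset α)) (c : List (Finset α) → K) :
    (orderSum A fun M => - c M) = - orderSum A c := by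
  induction A generalizing c with
  | nil => rfl
  | cons x A ih => simp only [orderSum, insertSum_neg, ih]

lemma orderSum_coboundary (A : List (Finset α)) (c : List (Finset α) → K) :
    (orderSum A fun M => coboundary M c) = 0 := by
  induction A generalizing c with
  | nil => rfl
  | cons x A ih => simp only [orderSum, insertSum_coboundary, orderSum_neg, ih, neg_zero]

/-- Up to the homotopy `splitSum x`, a cocycle `c` is concentrated on the lists that begin with `x`,
where it becomes the function `insertSum x L c` on ordered partitions of `A`. This is again a
cocycle since `insertSum` anticommutes with `coboundary`, so induction applies. Lists of all lengths
are treated at once; the grading is restored in `exists_boundaryMap_eq`. -/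
theorem exists_coboundary_eq (A : List (Finset α)) (hA : IsDisjoint A)
    (c : List (Finset α) → K) (hc : ∀ L, IsOrderedPartition A L → coboundary L c = 0)
    (h0 : orderSum A c = 0) :
    ∃ c' : List (Finset α) → K, ∀ L, IsOrderedPartition A L → c L = coboundary L c' := by
  induction A generalizing c with
  | nil =>
    refine ⟨fun _ => 0, fun L hL => ?_⟩
    cases L with
    | nil => simpa [coboundary, orderSum] using h0
    | cons P L =>
      obtain ⟨i, hi⟩ := hL.right P (by simp)
      simpa using hL.cover P (by simp) i hi
  | cons x A ih =>
    have hx : x.Nonempty := hA.2 x (by simp)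
    obtain ⟨e, he⟩ := ih hA.tail (fun M => insertSum x M c) (fun L hL => by
      rw [← neg_eq_zero, ← insertSum_coboundary]
      exact insertSum_eq_zero fun M hM => hc M ((hL.cons hA).perm hM.symm)) h0
    -- The second term is `e` placed behind a leading block `x`. Its coboundary at `x :: L` is minus
    -- that of `e` at `L`, so subtracting it removes the correction term.
    refine ⟨fun L => splitSum x L c - (match L with | [] => 0 | P :: L => if P = x then e L else 0),
      fun L hL => ?_⟩
    have key := splitSum_coboundary x hx L hL.toAnd (hL.exists_le x (by simp)) c
    have h1 : (splitSum x L fun M => coboundary M c) = 0 :=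
      splitSum_eq_zero fun P N M h2 h3 h4 h5 =>
        hc M (((hL.perm h2).split hA (by simp) h3 h4).perm h5.symm)
    rw [h1, add_zero] at key
    rw [coboundary_sub, key, sub_sub, eq_comm, sub_eq_self]
    cases L with
    | nil => simp [headTerm, coboundary]
    | cons P L =>
      rw [coboundary_cons]
      -- No merge of two blocks equals `x`, because `x` is contained in a single block of the list.
      have h2 : mergeHead P (fun L => (match L with | [] => 0 | P :: L => if P = x then e L else 0 : K))
          L = 0 := by
        cases L with
        | nil => rfl
        | cons Q L =>
          simp only [mergeHead]
          rw [if_neg]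
          rintro rfl
          obtain ⟨R, hR, hxR⟩ := hL.exists_le (P ∪ Q) (by simp)
          have hP := hL.right P (by simp)
          have hQ := hL.right Q (by simp)
          have hPQ := (List.pairwise_cons.1 hL.left).1 Q (by simp)
          have hPR : P = R := by
            by_contra hne
            exact hP.ne_empty (Finset.disjoint_self_iff_empty _ |>.1
              ((hL.left.forall (by simp) hR hne).mono_right
                (Finset.subset_union_left.trans hxR)))
          subst hPR
          exact hQ.ne_empty (Finset.disjoint_self_iff_empty _ |>.1
            (hPQ.mono_left (Finset.subset_union_right.trans hxR)))
      rw [h2, zero_sub]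
      by_cases hPx : P = x
      · subst hPx
        simp [headTerm, he L (hL.of_cons hA)]
      · simp [headTerm, hPx, coboundary_zero]

end Coboundary
end BlockList

namespace BlockList

/-! ### Signs of block orderings, and the passage from merging to splitting -/

section Sign

set_option linter.unusedSectionVars false

variable {K : Type*} [CommRing K] {α : Type*} [LinearOrder α]

lemma coboundary_mul (a : K) (L : List (Finset α)) (c : List (Finset α) → K) :
    (coboundary L fun M => a * c M) = a * coboundary L c := by
  induction L generalizing c with
  | nil => simp [coboundary]
  | cons P L ih => cases L <;> simp [coboundary, ih, mul_sub]

lemma coboundary_add (L : List (Finset α)) (c c' : List (Finset α) → K) :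
    (coboundary L fun M => c M + c' M) = coboundary L c + coboundary L c' := by
  have := coboundary_sub L c fun M => - c' M
  simpa [coboundary_neg] using this

lemma insertSum_mul (x : Finset α) (a : K) (L : List (Finset α)) (c : List (Finset α) → K) :
    (insertSum x L fun M => a * c M) = a * insertSum x L c := by
  induction L generalizing c with
  | nil => simp [insertSum]
  | cons P L ih => simp [insertSum, ih, mul_sub]

lemma insertSum_add (x : Finset α) (L : List (Finset α)) (c c' : List (Finset α) → K) :
    (insertSum x L fun M => c M + c' M) = insertSum x L c + insertSum x L c' := by
  have := insertSum_sub x L c fun M => - c' M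
  simpa [insertSum_neg] using this

lemma orderSum_mul (a : K) (A : List (Finset α)) (c : List (Finset α) → K) :
    (orderSum A fun M => a * c M) = a * orderSum A c := by
  induction A generalizing c with
  | nil => rfl
  | cons x A ih => simp only [orderSum, insertSum_mul, ih]

lemma orderSum_add (A : List (Finset α)) (c c' : List (Finset α) → K) :
    (orderSum A fun M => c M + c' M) = orderSum A c + orderSum A c' := by
  induction A generalizing c c' with
  | nil => rfl
  | cons x A ih => simp only [orderSum, insertSum_add, ih]

lemma orderSum_eq_zero {A : List (Finset α)} {c : List (Finset α) → K}
    (h : ∀ M, M.Perm A → c M = 0) : orderSum A c = 0 := by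
  induction A generalizing c with
  | nil => exact h _ (List.Perm.refl _)
  | cons x A ih =>
    exact ih fun M hM => insertSum_eq_zero fun N hN => h N (hN.trans (hM.cons x))

/-- The sign by which two blocks are compared. -/
def compareSign (K : Type*) [CommRing K] (P Q : Finset α) : K :=
  if toColex P ≤ toColex Q then 1 else -1

lemma compareSign_swap {P Q : Finset α} (h : P ≠ Q) :
    compareSign K Q P = - compareSign K P Q := by
  have h' : toColex P ≠ toColex Q := fun h' => h (toColex_inj.1 h')
  unfold compareSign
  rcases lt_or_gt_of_ne h' with h1 | h1
  · rw [if_neg (not_le.2 h1), if_pos h1.le]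
  · rw [if_pos h1.le, if_neg (not_le.2 h1), neg_neg]

lemma compareSign_mul_compareSign (P Q : Finset α) :
    compareSign K P Q * compareSign K P Q = 1 := by
  unfold compareSign; split_ifs <;> simp

/-- The sign of the permutation that sorts a list of blocks. -/
def sign (K : Type*) [CommRing K] : List (Finset α) → K
  | [] => 1
  | P :: L => (L.map (compareSign K P)).prod * sign K L

lemma sign_mul_sign (L : List (Finset α)) : sign K L * sign K L = 1 := by
  induction L with
  | nil => simp [sign]
  | cons P L ih =>
    have h : (L.map (compareSign K P)).prod * (L.map (compareSign K P)).prod = 1 := by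
      rw [← List.prod_map_mul]
      exact List.prod_eq_one fun a ha => by
        obtain ⟨Q, -, rfl⟩ := List.mem_map.1 ha
        exact compareSign_mul_compareSign P Q
    rw [sign]
    linear_combination ih + sign K L * sign K L * h

lemma sign_eq_erase {L : List (Finset α)} {x : Finset α} (hL : L.Nodup) (hx : x ∈ L) :
    sign K L = (-1) ^ L.idxOf x * ((L.erase x).map (compareSign K x)).prod *
      sign K (L.erase x) := by
  induction L with
  | nil => simp at hx
  | cons P L ih =>
    by_cases hPx : P = x
    · subst hPx
      simp [sign]
    · have hxL : x ∈ L := by simpa [Ne.symm hPx] using hx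
      have h2 : (L.map (compareSign K P)).prod =
          compareSign K P x * ((L.erase x).map (compareSign K P)).prod := by
        rw [((List.perm_cons_erase hxL).map _).prod_eq]; simp
      rw [sign, ih hL.of_cons hxL, h2, List.idxOf_cons_ne _ hPx,
        List.erase_cons_tail (by simpa using hPx), sign, compareSign_swap (Ne.symm hPx)]
      simp only [List.map_cons, List.prod_cons, pow_succ]
      ring

lemma insertSum_single {x : Finset α} {L : List (Finset α)} (hL : L.Nodup) (hx : x ∈ L)
    (M : List (Finset α)) :
    (insertSum x M fun N => if N = L then (1 : K) else 0) =
      (-1) ^ L.idxOf x * if M = L.erase x then 1 else 0 := by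
  induction M generalizing L with
  | nil =>
    cases L with
    | nil => simp at hx
    | cons y L =>
      by_cases hy : y = x
      · subst hy; simp [insertSum]
      · simp [insertSum, hy, Ne.symm hy, List.erase_cons_tail]
  | cons Q M ih =>
    cases L with
    | nil => simp at hx
    | cons y L =>
      by_cases hy : y = x
      · subst hy
        have hyL : y ∉ L := (List.nodup_cons.1 hL).1
        rw [insertSum, insertSum_eq_zero]
        · simp
        · rintro N hN
          refine if_neg fun h => hyL ?_
          obtain ⟨rfl, rfl⟩ := List.cons.inj h
          exact hN.mem_iff.2 (by simp)
      · have hxL : x ∈ L := by simpa [Ne.symm hy] using hx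
        rw [insertSum, if_neg (by simp [Ne.symm hy]), List.idxOf_cons_ne _ hy,
          List.erase_cons_tail (by simpa using hy)]
        by_cases hQ : Q = y
        · subst hQ
          simp only [List.cons.injEq, true_and]
          rw [ih hL.of_cons hxL, pow_succ]
          ring
        · simp [hQ, insertSum_zero]

/-- In `orderSum`, an ordering `L` of `A` occurs with sign `sign L * sign A`. After the twist by
`sign`, `orderSum` therefore counts all orderings with equal weight, as the augmentation does. -/
lemma sign_mul_orderSum_single {A L : List (Finset α)} (hA : A.Nodup) (hL : L.Perm A) :
    sign K L * (orderSum A fun M => if M = L then (1 : K) else 0) = sign K A := by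
  induction A generalizing L with
  | nil => simp [orderSum, List.perm_nil.1 hL, sign]
  | cons x A ih =>
    have hLn : L.Nodup := hL.nodup_iff.2 hA
    have hx : x ∈ L := hL.mem_iff.2 (by simp)
    have hp : (L.erase x).Perm A := by simpa using hL.erase x
    simp only [orderSum, insertSum_single hLn hx]
    rw [orderSum_mul, sign_eq_erase hLn hx, sign, ← ih hA.of_cons hp, (hp.map _).prod_eq]
    have h : ((-1 : K) ^ L.idxOf x) * (-1) ^ L.idxOf x = 1 := by
      rw [← mul_pow]; simp
    linear_combination ((A.map (compareSign K x)).prod * (sign K (L.erase x) *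
      orderSum A fun M => if M = L.erase x then (1 : K) else 0)) * h

/-- Replace the block `P` of a list by `A` and `P \ A`. -/
def splitBlock (P A : Finset α) (L : List (Finset α)) : List (Finset α) :=
  L.flatMap fun Q => if Q = P then [A, P \ A] else [Q]

lemma splitBlock_cons_self {P A : Finset α} {L : List (Finset α)} (h : P ∉ L) :
    splitBlock P A (P :: L) = A :: (P \ A) :: L := by
  have : splitBlock P A L = L := by
    unfold splitBlock
    conv_rhs => rw [← List.flatMap_singleton' L]
    exact List.flatMap_congr fun Q hQ => by
      rw [if_neg fun h' => h (by rwa [h'] at hQ)]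
  simpa [splitBlock] using this

lemma splitBlock_cons_ne {P Q A : Finset α} {L : List (Finset α)} (h : Q ≠ P) :
    splitBlock P A (Q :: L) = Q :: splitBlock P A L := by
  simp [splitBlock, h]

/-- Evaluation at a delta function transposes the operator: a list `M` of disjoint nonempty blocks
merges to `L` exactly if it arises from `L` by splitting one block. -/
lemma coboundary_single {L : List (Finset α)} (hL : L.Nodup) {M : List (Finset α)}
    (hM : IsDisjoint M) :
    (coboundary M fun N => if N = L then (1 : K) else 0) =
      ∑ P ∈ L.toFinset, ∑ A ∈ P.ssubsets.erase ∅,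
        (-1) ^ L.idxOf P * if splitBlock P A L = M then 1 else 0 := by
  induction L generalizing M with
  | nil =>
    rw [coboundary_eq_zero]
    · simp
    · intros; simp
  | cons P L ih =>
    have hPL : P ∉ L := (List.nodup_cons.1 hL).1
    rw [List.toFinset_cons, Finset.sum_insert (by simpa using hPL)]
    have h1 : ∀ Q ∈ L.toFinset, (∑ A ∈ Q.ssubsets.erase ∅,
        (-1 : K) ^ (P :: L).idxOf Q * if splitBlock Q A (P :: L) = M then 1 else 0) =
        - ∑ A ∈ Q.ssubsets.erase ∅,
        (-1) ^ L.idxOf Q * if P :: splitBlock Q A L = M then 1 else 0 := by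
      intro Q hQ
      have hPQ : P ≠ Q := by rintro rfl; exact hPL (by simpa using hQ)
      rw [List.idxOf_cons_ne _ hPQ, ← Finset.sum_neg_distrib]
      refine Finset.sum_congr rfl fun A _ => ?_
      rw [splitBlock_cons_ne hPQ, pow_succ]
      ring
    rw [Finset.sum_congr rfl h1, Finset.sum_neg_distrib]
    simp only [List.idxOf_cons_self, pow_zero, one_mul, splitBlock_cons_self hPL]
    cases M with
    | nil => simp [coboundary]
    | cons Q N =>
      rw [coboundary_cons, ← sub_eq_add_neg]
      congr 1
      · cases N with
        | nil => simp [mergeHead]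
        | cons R N =>
          have hQR : Disjoint Q R := (List.pairwise_cons.1 hM.1).1 R (by simp)
          have hQ : Q.Nonempty := hM.2 Q (by simp)
          have hR : R.Nonempty := hM.2 R (by simp)
          simp only [mergeHead]
          by_cases h : Q ∪ R = P ∧ N = L
          · obtain ⟨rfl, rfl⟩ := h
            rw [if_pos rfl, Finset.sum_eq_single Q]
            · rw [if_pos]
              rw [Finset.union_sdiff_left, Finset.sdiff_eq_self_of_disjoint hQR.symm]
            · intro A _ hA
              exact if_neg fun h => hA (List.cons.inj h).1
            · intro h
              refine absurd ?_ h
              rw [Finset.mem_erase, Finset.mem_ssubsets]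
              refine ⟨hQ.ne_empty, Finset.subset_union_left, fun h => hR.ne_empty ?_⟩
              exact Finset.disjoint_self_iff_empty _ |>.1
                (hQR.mono_left (Finset.subset_union_right.trans h))
          · rw [if_neg (by simpa using h), eq_comm]
            refine Finset.sum_eq_zero fun A hA => if_neg fun h' => h ?_
            rw [Finset.mem_erase, Finset.mem_ssubsets] at hA
            simp only [List.cons.injEq] at h'
            obtain ⟨rfl, rfl, rfl⟩ := h'
            exact ⟨Finset.union_sdiff_of_subset hA.2.1, rfl⟩
      · by_cases hQP : Q = P
        · subst hQP
          simpa using ih hL.of_cons hM.tail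
        · simp [hQP, Ne.symm hQP, coboundary_zero]

/-- The sign with which the pieces `A`, `P \ A` of the block `P` occur in the boundary of an ordered
partition with set of blocks `Z`. -/
def splitSign (K : Type*) [CommRing K] (Z : Finset (Finset α)) (P A : Finset α) : K :=
  compareSign K A (P \ A) * ∏ Q ∈ Z.erase P,
    -(compareSign K Q A * compareSign K Q (P \ A) * compareSign K Q P)

/-- Exchange of the two pieces affects only the factor that compares them. This antisymmetry
produces the cancellation in `smul_boundarySum`. -/
lemma splitSign_compl {Z : Finset (Finset α)} {P A : Finset α} (hA : A ⊂ P) (hA' : A.Nonempty) :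
    splitSign K Z P (P \ A) = - splitSign K Z P A := by
  have h : P \ (P \ A) = A := by rw [Finset.sdiff_sdiff_eq_self hA.1]
  have hne : A ≠ P \ A := by
    intro h
    have : Disjoint A A := by
      conv_rhs => rw [h]
      exact Finset.disjoint_sdiff
    exact hA'.ne_empty (Finset.disjoint_self_iff_empty _ |>.1 this)
  rw [splitSign, h, compareSign_swap hne, splitSign, neg_mul]
  congr 2
  refine Finset.prod_congr rfl fun Q _ => ?_
  ring

lemma prod_map_splitBlock (g : Finset α → K) {P A : Finset α} {L : List (Finset α)}
    (hL : L.Nodup) (hP : P ∈ L) :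
    ((splitBlock P A L).map g).prod * g P = g A * g (P \ A) * (L.map g).prod := by
  induction L with
  | nil => simp at hP
  | cons Q L ih =>
    by_cases hQ : Q = P
    · subst hQ
      rw [splitBlock_cons_self (List.nodup_cons.1 hL).1]
      simp only [List.map_cons, List.prod_cons]
      ring
    · rw [splitBlock_cons_ne hQ]
      have := ih hL.of_cons (by simpa [Ne.symm hQ] using hP)
      simp only [List.map_cons, List.prod_cons]
      linear_combination g Q * this

lemma IsDisjoint.nodup {L : List (Finset α)} (hL : IsDisjoint L) : L.Nodup :=
  hL.1.imp_of_mem fun {P Q} hP _ h => by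
    rintro rfl
    exact (hL.2 P hP).ne_empty (disjoint_self.1 h)

/-- The twist by `sign` absorbs the positional sign, leaving `splitSign`, which sees only the set of
blocks. A block `Q` after `P` needs three swaps to be compared in the order `Q, A`, `Q, P \ A`, `Q,
P`, whence the minus sign in `splitSign`; for `Q` before `P` no swap is needed, and that minus sign
is offset by the power of `-1`. -/
lemma sign_splitBlock {L : List (Finset α)} (hL : IsDisjoint L) {P A : Finset α} (hP : P ∈ L)
    (hA : A ⊂ P) (hA' : A.Nonempty) :
    sign K (splitBlock P A L) = (-1) ^ L.idxOf P * splitSign K L.toFinset P A * sign K L := by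
  induction L with
  | nil => simp at hP
  | cons Q L ih =>
    have hn := hL.nodup
    have hQL : Q ∉ L := (List.nodup_cons.1 hn).1
    have hdisj := (List.pairwise_cons.1 hL.1).1
    by_cases hQ : Q = P
    · subst hQ
      have hB : (Q \ A).Nonempty := Finset.sdiff_nonempty.2 hA.2
      have hne : ∀ B : Finset α, B ⊆ Q → B.Nonempty → ∀ R ∈ L, R ≠ B := by
        rintro B hB hBn R hR rfl
        exact hBn.ne_empty (Finset.disjoint_self_iff_empty _ |>.1 ((hdisj R hR).mono_left hB))
      rw [splitBlock_cons_self hQL, splitSign, List.toFinset_cons,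
        Finset.erase_insert (by simpa using hQL), List.prod_toFinset _ hn.of_cons]
      have h1 : (L.map fun R => -(compareSign K R A * compareSign K R (Q \ A) *
          compareSign K R Q)).prod = (L.map (compareSign K A)).prod *
            (L.map (compareSign K (Q \ A))).prod * (L.map (compareSign K Q)).prod := by
        rw [← List.prod_map_mul, ← List.prod_map_mul]
        congr 1
        refine List.map_congr_left fun R hR => ?_
        rw [compareSign_swap (hne A hA.1 hA' R hR),
          compareSign_swap (hne _ Finset.sdiff_subset hB R hR),
          compareSign_swap (hne Q subset_rfl (hL.2 Q (by simp)) R hR)]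
        ring
      have h2 : (L.map (compareSign K Q)).prod * (L.map (compareSign K Q)).prod = 1 := by
        rw [← List.prod_map_mul]
        exact List.prod_eq_one fun a ha => by
          obtain ⟨R, -, rfl⟩ := List.mem_map.1 ha
          exact compareSign_mul_compareSign Q R
      rw [h1]
      simp only [sign, List.map_cons, List.prod_cons, List.idxOf_cons_self, pow_zero, one_mul]
      linear_combination -(compareSign K A (Q \ A) * (L.map (compareSign K A)).prod *
            (L.map (compareSign K (Q \ A))).prod * sign K L) * h2
    · have hPL : P ∈ L := by simpa [Ne.symm hQ] using hP
      have ih := ih hL.tail hPL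
      have h1 := prod_map_splitBlock (compareSign K Q) (A := A) hn.of_cons hPL
      have h2 := compareSign_mul_compareSign (K := K) Q P
      have h3 : splitSign K (Q :: L).toFinset P A = -(compareSign K Q A *
          compareSign K Q (P \ A) * compareSign K Q P) * splitSign K L.toFinset P A := by
        rw [splitSign, splitSign, List.toFinset_cons, Finset.erase_insert_of_ne hQ,
          Finset.prod_insert (by simp [hQL])]
        ring
      rw [splitBlock_cons_ne hQ, sign, ih, h3, List.idxOf_cons_ne _ hQ, sign, pow_succ]
      linear_combination (-1) ^ L.idxOf P * splitSign K L.toFinset P A * sign K L *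
        (compareSign K Q P * h1 - ((splitBlock P A L).map (compareSign K Q)).prod * h2)

lemma sign_mul_coboundary_single {L M : List (Finset α)} (hL : IsDisjoint L)
    (hM : IsDisjoint M) :
    sign K M * (coboundary M fun N => sign K N * if N = L then (1 : K) else 0) =
      ∑ P ∈ L.toFinset, ∑ A ∈ P.ssubsets.erase ∅,
        splitSign K L.toFinset P A * if splitBlock P A L = M then 1 else 0 := by
  have h1 : (fun N => sign K N * if N = L then (1 : K) else 0) =
      fun N => sign K L * if N = L then (1 : K) else 0 := by
    funext N; split_ifs with h <;> simp [h]
  rw [h1, coboundary_mul, coboundary_single hL.nodup hM, Finset.mul_sum, Finset.mul_sum]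
  refine Finset.sum_congr rfl fun P hP => ?_
  rw [Finset.mul_sum, Finset.mul_sum]
  refine Finset.sum_congr rfl fun A hA => ?_
  split_ifs with h
  · rw [Finset.mem_erase, Finset.mem_ssubsets] at hA
    subst h
    rw [sign_splitBlock hL (by simpa using hP) hA.2 (Finset.nonempty_iff_ne_empty.2 hA.1)]
    have h2 : ((-1 : K) ^ L.idxOf P) * (-1) ^ L.idxOf P = 1 := by
      rw [← mul_pow]; simp
    have h3 := sign_mul_sign (K := K) L
    linear_combination splitSign K L.toFinset P A * (sign K L * sign K L * h2 + h3)
  · simp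

end Sign
end BlockList

/-! ### Products and splittings of ordered set partitions -/

namespace OrderedSetPartition

variable {n : ℕ}

lemma isDisjoint_blocks (F : OrderedSetPartition n) : BlockList.IsDisjoint F.blocks :=
  ⟨F.disjoint, F.nonempty⟩

lemma blocks_injective : Function.Injective (blocks : OrderedSetPartition n → _) :=
  fun _ _ h => OrderedSetPartition.ext h

lemma parts_shape (F : OrderedSetPartition n) : F.shape.parts = F.blocks.toFinset := rfl

lemma card_parts_shape (F : OrderedSetPartition n) : F.shape.parts.card = F.blocks.length :=
  List.toFinset_card_of_nodup F.isDisjoint_blocks.nodup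

lemma exists_shape_eq (Z : SetPartition n) : ∃ F : OrderedSetPartition n, F.shape = Z := by
  refine ⟨⟨Z.parts.toList, fun P hP => Z.nonempty_of_mem_parts (by simpa using hP), ?_, ?_⟩, ?_⟩
  · refine (Finset.nodup_toList _).imp_of_mem fun {P Q} hP hQ h => ?_
    exact Z.disjoint (by simpa using hP) (by simpa using hQ) h
  · intro i
    obtain ⟨P, hP, hi⟩ := Z.exists_mem (Finset.mem_univ i)
    exact ⟨P, by simpa using hP, hi⟩
  · ext P
    simp [parts_shape]

lemma shape_mul_of_le {F b : OrderedSetPartition n} (h : F.shape ≤ b.shape) :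
    (b * F).shape = F.shape := by
  rw [shape_mul, inf_eq_right.2 h]

lemma filter_map_inter_of_subset {p q : Finset (Fin n)} {L : List (Finset (Fin n))}
    (hL : L.Pairwise Disjoint) (hq : q ∈ L) (hpq : p ⊆ q) (hp : p.Nonempty) :
    (L.map fun q => p ∩ q).filter (fun s => decide s.Nonempty) = [p] := by
  induction L with
  | nil => simp at hq
  | cons a L ih =>
    obtain ⟨h1, h2⟩ := List.pairwise_cons.1 hL
    rcases List.mem_cons.1 hq with rfl | hq
    · have h3 : (L.map fun q => p ∩ q).filter (fun s => decide s.Nonempty) = [] := by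
        rw [List.filter_eq_nil_iff]
        intro s hs
        obtain ⟨r, hr, rfl⟩ := List.mem_map.1 hs
        simpa [Finset.not_nonempty_iff_eq_empty, ← Finset.disjoint_iff_inter_eq_empty] using
          (h1 r hr).mono_left hpq
      simp [h3, Finset.inter_eq_left.2 hpq, hp]
    · have h3 : p ∩ a = ∅ :=
        Finset.disjoint_iff_inter_eq_empty.1 ((h1 q hq).symm.mono_left hpq)
      simp [h3, ih h2 hq]

lemma blocks_mul' (b F : OrderedSetPartition n) : (b * F).blocks = b.blocks.flatMap fun p =>
    (F.blocks.map fun q => p ∩ q).filter fun s => decide s.Nonempty := by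
  rw [blocks_mul, interList, List.filter_flatMap]

/-- Each block of `F` meets only the block of `b` that contains it. In particular `E * F = E` for
`E` and `F` of equal shape. -/
lemma mul_eq_left_of_le {F b : OrderedSetPartition n} (h : F.shape ≤ b.shape) : F * b = F := by
  apply OrderedSetPartition.ext
  rw [blocks_mul']
  conv_rhs => rw [← List.flatMap_singleton' F.blocks]
  refine List.flatMap_congr fun p hp => ?_
  obtain ⟨q, hq, hpq⟩ := h (mem_parts_shape.2 hp)
  exact filter_map_inter_of_subset b.disjoint (mem_parts_shape.1 hq) hpq (F.nonempty p hp)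

open BlockList in
/-- Replace the block `P` of an ordered set partition by `A` and `P \ A`. (This is the given ordered
set partition unless `A` is a nonempty proper subset of `P`.) -/
def split (F : OrderedSetPartition n) (P A : Finset (Fin n)) : OrderedSetPartition n :=
  if h : A.Nonempty ∧ A ⊂ P then
    { blocks := splitBlock P A F.blocks
      nonempty := fun s hs => by
        obtain ⟨Q, hQ, hs⟩ := List.mem_flatMap.1 hs
        split_ifs at hs with hQP
        · simp only [List.mem_cons, List.not_mem_nil, or_false] at hs
          rcases hs with rfl | rfl
          · exact h.1
          · exact Finset.sdiff_nonempty.2 h.2.2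
        · rw [List.mem_singleton.1 hs]; exact F.nonempty Q hQ
      disjoint := by
        have hsub : ∀ Q, ∀ s ∈ (if Q = P then [A, P \ A] else [Q]), s ⊆ Q := by
          intro Q s hs
          split_ifs at hs with hQP
          · simp only [List.mem_cons, List.not_mem_nil, or_false] at hs
            rcases hs with rfl | rfl
            · exact hQP ▸ h.2.1
            · exact hQP ▸ Finset.sdiff_subset
          · rw [List.mem_singleton.1 hs]
        rw [splitBlock, List.pairwise_flatMap]
        refine ⟨fun Q _ => ?_, F.disjoint.imp fun hd s hs t ht =>
          hd.mono (hsub _ s hs) (hsub _ t ht)⟩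
        split_ifs
        · simpa using Finset.disjoint_sdiff
        · simp
      cover := fun i => by
        obtain ⟨Q, hQ, hi⟩ := F.cover i
        by_cases hQP : Q = P
        · by_cases hiA : i ∈ A
          · exact ⟨A, List.mem_flatMap.2 ⟨Q, hQ, by simp [hQP]⟩, hiA⟩
          · exact ⟨P \ A, List.mem_flatMap.2 ⟨Q, hQ, by simp [hQP]⟩, by simp [hiA, ← hQP, hi]⟩
        · exact ⟨Q, List.mem_flatMap.2 ⟨Q, hQ, by simp [hQP]⟩, hi⟩ }
  else F

variable {P A : Finset (Fin n)}

lemma blocks_split (F : OrderedSetPartition n) (hA : A.Nonempty) (hAP : A ⊂ P) :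
    (F.split P A).blocks = BlockList.splitBlock P A F.blocks := by
  simp [split, hA, hAP]

lemma mem_blocks_split (F : OrderedSetPartition n) (hA : A.Nonempty) (hAP : A ⊂ P)
    (hP : P ∈ F.blocks) {s : Finset (Fin n)} :
    s ∈ (F.split P A).blocks ↔ s = A ∨ s = P \ A ∨ (s ∈ F.blocks ∧ s ≠ P) := by
  rw [blocks_split F hA hAP, BlockList.splitBlock, List.mem_flatMap]
  constructor
  · rintro ⟨Q, hQ, hs⟩
    split_ifs at hs with hQP
    · simp only [List.mem_cons, List.not_mem_nil, or_false] at hs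
      tauto
    · rw [List.mem_singleton.1 hs]; tauto
  · rintro (rfl | rfl | ⟨hs, hsP⟩)
    · exact ⟨P, hP, by simp⟩
    · exact ⟨P, hP, by simp⟩
    · exact ⟨s, hs, by simp [hsP]⟩

lemma shape_split_le (F : OrderedSetPartition n) (hA : A.Nonempty) (hAP : A ⊂ P)
    (hP : P ∈ F.blocks) : (F.split P A).shape ≤ F.shape := by
  intro s hs
  rw [mem_parts_shape, mem_blocks_split F hA hAP hP] at hs
  rcases hs with rfl | rfl | ⟨hs, -⟩
  · exact ⟨P, mem_parts_shape.2 hP, hAP.1⟩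
  · exact ⟨P, mem_parts_shape.2 hP, Finset.sdiff_subset⟩
  · exact ⟨s, mem_parts_shape.2 hs, subset_rfl⟩

lemma shape_split_sdiff (F : OrderedSetPartition n) (hA : A.Nonempty) (hAP : A ⊂ P)
    (hP : P ∈ F.blocks) : (F.split P (P \ A)).shape = (F.split P A).shape := by
  ext s
  rw [mem_parts_shape, mem_parts_shape, mem_blocks_split F hA hAP hP, mem_blocks_split F
    (Finset.sdiff_nonempty.2 hAP.2) (Finset.sdiff_ssubset hAP.1 hA) hP,
    Finset.sdiff_sdiff_eq_self hAP.1]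
  tauto

lemma filter_map_inter_splitBlock (hA : A.Nonempty) (hAP : A ⊂ P) (p : Finset (Fin n))
    (L : List (Finset (Fin n))) (hL : ∀ Q ∈ L, Q.Nonempty ∧ (Q ⊆ p ∨ Disjoint p Q)) :
    ((BlockList.splitBlock P A L).map fun q => p ∩ q).filter (fun s => decide s.Nonempty) =
      BlockList.splitBlock P A
        ((L.map fun q => p ∩ q).filter fun s => decide s.Nonempty) := by
  induction L with
  | nil => rfl
  | cons Q L ih =>
    have ih := ih fun R hR => hL R (by simp [hR])
    have h1 : BlockList.splitBlock P A (Q :: L) =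
        (if Q = P then [A, P \ A] else [Q]) ++ BlockList.splitBlock P A L := by
      simp [BlockList.splitBlock]
    rw [h1, List.map_append, List.filter_append, ih]
    obtain ⟨hQ, hQp | hQp⟩ := hL Q (by simp)
    · rw [List.map_cons, Finset.inter_eq_right.2 hQp, List.filter_cons_of_pos (by simpa using hQ)]
      have h2 : ∀ M, BlockList.splitBlock P A (Q :: M) =
        (if Q = P then [A, P \ A] else [Q]) ++ BlockList.splitBlock P A M := by
        simp [BlockList.splitBlock]
      rw [h2]
      congr 1
      split_ifs with hQP
      · subst hQP
        have hB : (Q \ A).Nonempty := Finset.sdiff_nonempty.2 hAP.2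
        simp [Finset.inter_eq_right.2 (hAP.1.trans hQp),
          Finset.inter_eq_right.2 ((Finset.sdiff_subset (t := A)).trans hQp), hA, hB]
      · simp [Finset.inter_eq_right.2 hQp, hQ]
    · rw [List.map_cons, Finset.disjoint_iff_inter_eq_empty.1 hQp,
        List.filter_cons_of_neg (by simp)]
      have : (List.map (fun q => p ∩ q) (if Q = P then [A, P \ A] else [Q])).filter
          (fun s => decide s.Nonempty) = [] := by
        split_ifs with hQP
        · subst hQP
          simp [Finset.disjoint_iff_inter_eq_empty.1 (hQp.mono_right hAP.1),
            Finset.disjoint_iff_inter_eq_empty.1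
              (hQp.mono_right (Finset.sdiff_subset (t := A)))]
        · simp [Finset.disjoint_iff_inter_eq_empty.1 hQp]
      rw [this, List.nil_append]

lemma subset_or_disjoint_of_le {F b : OrderedSetPartition n} (h : F.shape ≤ b.shape)
    {p Q : Finset (Fin n)} (hp : p ∈ b.blocks) (hQ : Q ∈ F.blocks) : Q ⊆ p ∨ Disjoint p Q := by
  obtain ⟨q, hq, hQq⟩ := h (mem_parts_shape.2 hQ)
  by_cases hqp : p = q
  · subst hqp; exact Or.inl hQq
  · exact Or.inr ((b.disjoint.forall hp (mem_parts_shape.1 hq) hqp).mono_right hQq)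

/-- Here `b * F` is `F` with its blocks grouped by the blocks of `b`. Adjacent pieces of a block of
`F` stay in the same group, and so stay adjacent. -/
lemma mul_split {F b : OrderedSetPartition n} (h : F.shape ≤ b.shape) (hA : A.Nonempty)
    (hAP : A ⊂ P) : b * F.split P A = (b * F).split P A := by
  apply OrderedSetPartition.ext
  rw [blocks_mul', blocks_split _ hA hAP, blocks_split _ hA hAP, blocks_mul',
    BlockList.splitBlock, BlockList.splitBlock, List.flatMap_assoc]
  refine List.flatMap_congr fun p hp => ?_
  exact filter_map_inter_splitBlock hA hAP p F.blocks fun Q hQ =>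
    ⟨F.nonempty Q hQ, subset_or_disjoint_of_le h hp hQ⟩

/-- The pieces `A` and `P \ A` lie in different blocks of `b`, so their order in the product is
dictated by `b`. -/
lemma mul_split_sdiff {F b : OrderedSetPartition n} (h : ¬ F.shape ≤ b.shape) (hA : A.Nonempty)
    (hAP : A ⊂ P) (hP : P ∈ F.blocks) (hs : (F.split P A).shape ≤ b.shape) :
    b * F.split P (P \ A) = b * F.split P A := by
  have hB : (P \ A).Nonempty := Finset.sdiff_nonempty.2 hAP.2
  have hBP : P \ A ⊂ P := Finset.sdiff_ssubset hAP.1 hA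
  -- All blocks of `F` other than `P` survive in the split and lie in blocks of `b`; hence `P`
  -- itself must cross blocks of `b`.
  have hPb : ∀ p ∈ b.blocks, ¬ P ⊆ p := by
    intro p hp hPp
    refine h fun Q hQ => ?_
    by_cases hQP : Q = P
    · exact ⟨p, mem_parts_shape.2 hp, hQP ▸ hPp⟩
    · exact hs (mem_parts_shape.2 ((mem_blocks_split F hA hAP hP).2
        (Or.inr (Or.inr ⟨mem_parts_shape.1 hQ, hQP⟩))))
  apply OrderedSetPartition.ext
  rw [blocks_mul', blocks_mul', blocks_split _ hA hAP, blocks_split _ hB hBP,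
    BlockList.splitBlock, BlockList.splitBlock]
  refine List.flatMap_congr fun p hp => ?_
  simp only [List.map_flatMap, List.filter_flatMap]
  refine List.flatMap_congr fun Q _ => ?_
  split_ifs
  · rw [Finset.sdiff_sdiff_eq_self hAP.1]
    have h1 := subset_or_disjoint_of_le hs hp ((mem_blocks_split F hA hAP hP).2 (Or.inl rfl))
    have h2 := subset_or_disjoint_of_le hs hp
      ((mem_blocks_split F hA hAP hP).2 (Or.inr (Or.inl rfl)))
    rcases h1 with h1 | h1
    · rcases h2 with h2 | h2
      · refine absurd ?_ (hPb p hp)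
        rw [← Finset.union_sdiff_of_subset hAP.1]
        exact Finset.union_subset h1 h2
      · simp [Finset.disjoint_iff_inter_eq_empty.1 h2, List.filter_cons]
    · simp [Finset.disjoint_iff_inter_eq_empty.1 h1, List.filter_cons]
  · rfl

end OrderedSetPartition

/-! ### Dimension shifting along a projective resolution cut into short exact sequences -/

section DimensionShift

open CategoryTheory Abelian

universe w u₁ v₁

variable {k : Type*} [Field k] {C : Type u₁} [Category.{v₁} C] [Abelian C] [HasExt.{w} C]
  [Linear k C]

/-- `Ext^q` of `N 0` is reached by connecting maps from `Hom(N q, T)`, which embeds into `Hom(V q,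
T)`. -/
lemma subsingleton_ext_of_subsingleton_hom (T : C) (q : ℕ) (V N : ℕ → C) (ι : ∀ j, N (j + 1) ⟶ V j)
    (π : ∀ j, V j ⟶ N j) (w : ∀ j, ι j ≫ π j = 0)
    (hS : ∀ j, (ShortComplex.mk (ι j) (π j) (w j)).ShortExact) [∀ j, Projective (V j)]
    (h : Subsingleton (V q ⟶ T)) : Subsingleton (Ext.{w} (N 0) T q) := by
  induction q generalizing V N with
  | zero =>
    have : Epi (π 0) := (hS 0).epi_g
    have : Subsingleton (N 0 ⟶ T) := ⟨fun a b => (cancel_epi (π 0)).1 (h.elim _ _)⟩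
    exact Ext.homEquiv₀.injective.subsingleton
  | succ q ih =>
    have h1 := ih (fun j => V (j + 1)) (fun j => N (j + 1)) (fun j => ι (j + 1))
      (fun j => π (j + 1)) (fun j => w (j + 1)) (fun j => hS (j + 1)) h
    refine subsingleton_of_forall_eq 0 fun x => ?_
    obtain ⟨y, rfl⟩ := Ext.contravariant_sequence_exact₃ (hS 0) T x
      (Ext.eq_zero_of_projective _) (add_comm 1 q)
    rw [h1.elim y 0, Ext.comp_zero]

-- If only `V q` maps nontrivially to `T`, the Hom complex has zero differentials. The connecting
-- maps are then isomorphisms: the first one because `Hom(V 0, T) = 0` when `q > 0`, the later ones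
-- by the induction on the shifted resolution.
variable (k) in
lemma nonempty_ext_linearEquiv_hom (T : C) (q : ℕ) (V N : ℕ → C) (ι : ∀ j, N (j + 1) ⟶ V j)
    (π : ∀ j, V j ⟶ N j) (w : ∀ j, ι j ≫ π j = 0)
    (hS : ∀ j, (ShortComplex.mk (ι j) (π j) (w j)).ShortExact) [∀ j, Projective (V j)]
    (h : ∀ j, j ≠ q → Subsingleton (V j ⟶ T)) :
    Nonempty (Ext.{w} (N 0) T q ≃ₗ[k] (V q ⟶ T)) := by
  induction q generalizing V N with
  | zero =>
    have : Epi (π 0) := (hS 0).epi_g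
    have : Epi (π 1) := (hS 1).epi_g
    refine ⟨Ext.linearEquiv₀.trans (LinearEquiv.ofBijective (Linear.leftComp k T (π 0)) ⟨?_, ?_⟩)⟩
    · exact fun a b hab => (cancel_epi (π 0)).1 hab
    · intro f
      -- The syzygy `N 1` is a quotient of `V 1`, which has no nonzero map to `T`.
      have hf : ι 0 ≫ f = 0 := by
        rw [← cancel_epi (π 1)]
        exact (h 1 one_ne_zero).elim _ _
      have := (hS 0).epi_g
      exact ⟨(hS 0).exact.desc f hf, (hS 0).exact.g_desc f hf⟩
  | succ q ih =>
    obtain ⟨e⟩ := ih (fun j => V (j + 1)) (fun j => N (j + 1)) (fun j => ι (j + 1))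
      (fun j => π (j + 1)) (fun j => w (j + 1)) (fun j => hS (j + 1))
      (fun j hj => h (j + 1) (by simpa using hj))
    refine ⟨LinearEquiv.trans (LinearEquiv.symm (LinearEquiv.ofBijective
      (Ext.precompOfLinear (hS 0).extClass k T (add_comm 1 q)) ⟨?_, ?_⟩)) e⟩
    · rw [← LinearMap.ker_eq_bot, LinearMap.ker_eq_bot']
      intro x hx
      obtain ⟨y, rfl⟩ := Ext.contravariant_sequence_exact₁ (hS 0) T x (add_comm 1 q) hx
      have hy : y = 0 := by
        cases q with
        | zero =>
          refine Ext.homEquiv₀.injective ((h 0 (by simp)).elim _ _)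
        | succ q => exact Ext.eq_zero_of_projective _
      rw [hy, Ext.comp_zero]
    · intro x
      exact Ext.contravariant_sequence_exact₃ (hS 0) T x (Ext.eq_zero_of_projective _)
        (add_comm 1 q)

end DimensionShift

/-! ### Resolutions of modules by exact sequences of linear maps -/

section ModuleResolution

open CategoryTheory Abelian

universe u₁ u₂

variable {k : Type*} [Field k] {A : Type u₂} [Ring A] [Algebra k A]
  {S T : Type u₁} [AddCommGroup S] [Module A S] [AddCommGroup T] [Module A T]
  (V : ℕ → Type u₁) [∀ j, AddCommGroup (V j)] [∀ j, Module A (V j)]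
  (d : ∀ j, V (j + 1) →ₗ[A] V j) (ε : V 0 →ₗ[A] S)

lemma exists_shortExact_of_exact (hε : Function.Surjective ε) (h0 : Function.Exact (d 0) ε)
    (hd : ∀ j, Function.Exact (d (j + 1)) (d j)) :
    ∃ (N : ℕ → ModuleCat.{u₁} A) (_ : N 0 = ModuleCat.of A S)
      (ι : ∀ j, N (j + 1) ⟶ ModuleCat.of A (V j)) (π : ∀ j, ModuleCat.of A (V j) ⟶ N j)
      (w : ∀ j, ι j ≫ π j = 0), ∀ j, (ShortComplex.mk (ι j) (π j) (w j)).ShortExact := by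
  -- The syzygies, as images of the differentials; in degree zero the resolved module itself.
  let N : ℕ → ModuleCat.{u₁} A
    | 0 => ModuleCat.of A S
    | j + 1 => ModuleCat.of A (LinearMap.range (d j))
  let ι : ∀ j, N (j + 1) ⟶ ModuleCat.of A (V j) := fun j => ModuleCat.ofHom (Submodule.subtype _)
  let π : ∀ j, ModuleCat.of A (V j) ⟶ N j
    | 0 => ModuleCat.ofHom ε
    | j + 1 => ModuleCat.ofHom (d j).rangeRestrict
  have hex : ∀ j, Function.Exact (ι j) (π j) := by
    intro j
    cases j with
    | zero =>
      intro x
      change ε x = 0 ↔ _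
      rw [h0 x]
      constructor
      · rintro ⟨y, rfl⟩; exact ⟨⟨_, y, rfl⟩, rfl⟩
      · rintro ⟨⟨_, y, rfl⟩, rfl⟩; exact ⟨y, rfl⟩
    | succ j =>
      intro x
      change (d j).rangeRestrict x = 0 ↔ _
      rw [Subtype.ext_iff]
      change d j x = 0 ↔ _
      rw [hd j x]
      constructor
      · rintro ⟨y, rfl⟩; exact ⟨⟨_, y, rfl⟩, rfl⟩
      · rintro ⟨⟨_, y, rfl⟩, rfl⟩; exact ⟨y, rfl⟩
  have w : ∀ j, ι j ≫ π j = 0 := fun j => by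
    ext x
    exact (hex j _).2 ⟨x, rfl⟩
  refine ⟨N, rfl, ι, π, w, fun j => ?_⟩
  have hm : Mono (ι j) := (ModuleCat.mono_iff_injective _).2 Subtype.val_injective
  have he : Epi (π j) := by
    rw [ModuleCat.epi_iff_surjective]
    cases j with
    | zero => exact hε
    | succ j => exact LinearMap.surjective_rangeRestrict _
  exact { exact := (ShortComplex.ShortExact.moduleCat_exact_iff_function_exact _).2 (hex j) }

variable [Small.{u₁} A] [∀ j, Module.Projective A (V j)]

lemma subsingleton_ext_of_exact (hε : Function.Surjective ε) (h0 : Function.Exact (d 0) ε)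
    (hd : ∀ j, Function.Exact (d (j + 1)) (d j)) (q : ℕ) (h : Subsingleton (V q →ₗ[A] T)) :
    Subsingleton (Ext.{u₁} (ModuleCat.of A S) (ModuleCat.of A T) q) := by
  obtain ⟨N, hN, ι, π, w, hS⟩ := exists_shortExact_of_exact V d ε hε h0 hd
  rw [← hN]
  exact subsingleton_ext_of_subsingleton_hom _ q _ N ι π w hS
    (ModuleCat.homEquiv.injective.subsingleton)

variable (k) in
lemma nonempty_ext_linearEquiv_of_exact (hε : Function.Surjective ε)
    (h0 : Function.Exact (d 0) ε) (hd : ∀ j, Function.Exact (d (j + 1)) (d j)) (q : ℕ)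
    (h : ∀ j, j ≠ q → Subsingleton (V j →ₗ[A] T)) :
    Nonempty (Ext.{u₁} (ModuleCat.of A S) (ModuleCat.of A T) q ≃ₗ[k]
      (ModuleCat.of A (V q) ⟶ ModuleCat.of A T)) := by
  obtain ⟨N, hN, ι, π, w, hS⟩ := exists_shortExact_of_exact V d ε hε h0 hd
  rw [← hN]
  exact nonempty_ext_linearEquiv_hom k _ q (fun j => ModuleCat.of A (V j)) N ι π w hS fun j hj =>
    have := h j hj
    ModuleCat.homEquiv.injective.subsingleton

end ModuleResolution

/-! ### The modules of the resolution and the boundary map -/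

section ChainModule

open OrderedSetPartition
open scoped Classical

variable {n : ℕ} {K : Type u} [Field K] {G : Type v} [Group G]

/-- The element `(π, g)` of Hsiao's monoid. -/
def hsiaoMk (π : OrderedSetPartition n) (g : blockSubgroup G π.shape) : hsiaoMonoid n G :=
  ⟨(π, g.1), g.2⟩

/-- The element `(π, 1)` of Hsiao's monoid. -/
def hsiaoOf (π : OrderedSetPartition n) : hsiaoMonoid n G := hsiaoMk π 1

lemma hsiaoMonoid_ext {a b : hsiaoMonoid n G} (h1 : a.1.1 = b.1.1) (h2 : a.1.2 = b.1.2) : a = b :=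
  Subtype.ext (Prod.ext h1 h2)

/-- The ordered set partitions whose underlying set partition satisfies `p`. -/
abbrev ShapedPartition (p : SetPartition n → Prop) : Type := {F : OrderedSetPartition n // p F.shape}

/-- The basis vector of an ordered set partition, or zero if `p` fails. -/
noncomputable def basisVector (K : Type u) [Field K] (p : SetPartition n → Prop)
    (F : OrderedSetPartition n) : ShapedPartition p →₀ K :=
  if h : p F.shape then Finsupp.single ⟨F, h⟩ 1 else 0

lemma basisVector_of_not {p : SetPartition n → Prop} {F : OrderedSetPartition n}
    (h : ¬ p F.shape) : basisVector K p F = 0 := dif_neg h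

lemma basisVector_val {p : SetPartition n → Prop} (F : ShapedPartition p) :
    basisVector K p F.1 = Finsupp.single F 1 := dif_pos F.2

lemma basisVector_apply {p : SetPartition n → Prop} (F : OrderedSetPartition n)
    (E : ShapedPartition p) : basisVector K p F E = if F.blocks = E.1.blocks then 1 else 0 := by
  unfold basisVector
  split_ifs with h1 h2 h2
  · rw [Finsupp.single_apply, if_pos]
    exact Subtype.ext (OrderedSetPartition.ext h2)
  · rw [Finsupp.single_apply, if_neg]
    rintro rfl
    exact h2 rfl
  · obtain rfl : F = E.1 := OrderedSetPartition.ext h2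
    exact absurd E.2 h1
  · rfl

lemma linearMap_ext_basisVector {p : SetPartition n → Prop} {N : Type*} [AddCommMonoid N]
    [Module K N] {φ ψ : (ShapedPartition p →₀ K) →ₗ[K] N}
    (h : ∀ F, p F.shape → φ (basisVector K p F) = ψ (basisVector K p F)) : φ = ψ := by
  refine Finsupp.lhom_ext' fun F => LinearMap.ext_ring ?_
  simpa [basisVector_val] using h F.1 F.2

/-- The linear map with given values at the basis vectors. -/
noncomputable def basisLift {p : SetPartition n → Prop} {N : Type*} [AddCommMonoid N]
    [Module K N] (v : OrderedSetPartition n → N) : (ShapedPartition p →₀ K) →ₗ[K] N :=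
  Finsupp.linearCombination K fun F => v F.1

lemma basisLift_basisVector {p : SetPartition n → Prop} {N : Type*} [AddCommMonoid N]
    [Module K N] (v : OrderedSetPartition n → N) (F : OrderedSetPartition n) :
    basisLift (p := p) v (basisVector K p F) = if p F.shape then v F else 0 := by
  unfold basisVector basisLift
  split_ifs with h <;> simp

variable (χ : hsiaoMonoid n G →* K) (p : SetPartition n → Prop)

/-- Left multiplication by the ordered set partition `π` times `χ m`, for `m = (π, g)`, on ordered
set partitions that are finer than `π`, and zero on the others. -/
noncomputable def chainAction (m : hsiaoMonoid n G) :
    (ShapedPartition p →₀ K) →ₗ[K] (ShapedPartition p →₀ K) :=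
  basisLift fun F => if F.shape ≤ m.1.1.shape then χ m • basisVector K p (m.1.1 * F) else 0

/-- The formula needs no assumption `p F.shape`: whenever the action is nonzero it preserves the
shape, so both sides vanish together outside `p`. -/
lemma chainAction_basisVector (m : hsiaoMonoid n G) (F : OrderedSetPartition n) :
    chainAction χ p m (basisVector K p F) =
      if F.shape ≤ m.1.1.shape then χ m • basisVector K p (m.1.1 * F) else 0 := by
  rw [chainAction, basisLift_basisVector]
  by_cases h : p F.shape
  · rw [if_pos h]
  · rw [if_neg h]
    split_ifs with h1
    · rw [basisVector_of_not (by rwa [shape_mul_of_le h1]), smul_zero]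
    · rfl

/-- The representation of Hsiao's monoid on the span of the ordered set partitions whose underlying
set partition satisfies `p`. -/
noncomputable def chainRep : Representation K (hsiaoMonoid n G) (ShapedPartition p →₀ K) where
  toFun := chainAction χ p
  map_one' := by
    refine linearMap_ext_basisVector fun F _ => ?_
    have h : F.shape ≤ (1 : hsiaoMonoid n G).1.1.shape := le_shape_one _
    rw [chainAction_basisVector, if_pos h, map_one, one_smul]
    exact congrArg (basisVector K p) (one_mul F)
  map_mul' a b := by
    refine linearMap_ext_basisVector fun F _ => ?_
    rw [Module.End.mul_apply, chainAction_basisVector, chainAction_basisVector]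
    have h1 : (a * b).1.1.shape = a.1.1.shape ⊓ b.1.1.shape := shape_mul _ _
    rw [h1]
    by_cases hb : F.shape ≤ b.1.1.shape
    · rw [if_pos hb, map_smul, chainAction_basisVector, shape_mul_of_le hb]
      by_cases ha : F.shape ≤ a.1.1.shape
      · rw [if_pos ha, if_pos (le_inf ha hb), map_mul, smul_smul, mul_comm (χ a)]
        exact congrArg (fun E => (χ b * χ a) • basisVector K p E) (mul_assoc a.1.1 b.1.1 F)
      · rw [if_neg ha, if_neg fun h => ha (le_inf_iff.1 h).1, smul_zero]
    · rw [if_neg hb, if_neg fun h => hb (le_inf_iff.1 h).2, map_zero]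

/-- The module of the representation `chainRep χ p`. -/
def ChainModule (_ : hsiaoMonoid n G →* K) (p : SetPartition n → Prop) : Type u :=
  ShapedPartition p →₀ K

noncomputable instance : AddCommGroup (ChainModule χ p) :=
  inferInstanceAs (AddCommGroup (ShapedPartition p →₀ K))

noncomputable instance : Module K (ChainModule χ p) :=
  inferInstanceAs (Module K (ShapedPartition p →₀ K))

noncomputable instance : Module (MonoidAlgebra K (hsiaoMonoid n G)) (ChainModule χ p) :=
  Module.compHom (ShapedPartition p →₀ K) (chainRep χ p).asAlgebraHom.toRingHom

instance : IsScalarTower K (MonoidAlgebra K (hsiaoMonoid n G)) (ChainModule χ p) where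
  smul_assoc a x y := by
    change (chainRep χ p).asAlgebraHom (a • x) (id y : ShapedPartition p →₀ K) =
      a • (chainRep χ p).asAlgebraHom x (id y : ShapedPartition p →₀ K)
    rw [map_smul]
    rfl

/-- The basis vectors of `ChainModule χ p`. -/
noncomputable def chainVector (F : OrderedSetPartition n) : ChainModule χ p :=
  basisVector K p F

lemma single_smul_chainVector (m : hsiaoMonoid n G) (F : OrderedSetPartition n) :
    (MonoidAlgebra.single m 1 : MonoidAlgebra K (hsiaoMonoid n G)) • chainVector χ p F =
      if F.shape ≤ m.1.1.shape then χ m • chainVector χ p (m.1.1 * F) else 0 := by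
  change (chainRep χ p).asAlgebraHom (MonoidAlgebra.single m 1) (basisVector K p F) = _
  rw [Representation.asAlgebraHom_single, one_smul]
  exact chainAction_basisVector χ p m F

variable {χ p} in
lemma chainModule_hom_ext {N : Type*} [AddCommMonoid N]
    [Module K N] {φ ψ : ChainModule χ p →ₗ[K] N}
    (h : ∀ F, p F.shape → φ (chainVector χ p F) = ψ (chainVector χ p F)) : φ = ψ :=
  linearMap_ext_basisVector h

lemma chainModule_linearMap_ext {N : Type*} [AddCommGroup N]
    [Module (MonoidAlgebra K (hsiaoMonoid n G)) N]
    {φ ψ : ChainModule χ p →ₗ[MonoidAlgebra K (hsiaoMonoid n G)] N}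
    (h : ∀ F, p F.shape → φ (chainVector χ p F) = ψ (chainVector χ p F)) : φ = ψ := by
  let _ : Module K N := Module.restrictScalars K (MonoidAlgebra K (hsiaoMonoid n G)) N
  have _ : IsScalarTower K (MonoidAlgebra K (hsiaoMonoid n G)) N :=
    IsScalarTower.restrictScalars K (MonoidAlgebra K (hsiaoMonoid n G)) N
  have := chainModule_hom_ext (φ := φ.restrictScalars K) (ψ := ψ.restrictScalars K) h
  exact LinearMap.ext fun x => LinearMap.congr_fun this x

/-- The linear map with given values at the basis vectors. -/
noncomputable def chainLift {N : Type*} [AddCommMonoid N]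
    [Module K N] (v : OrderedSetPartition n → N) : ChainModule χ p →ₗ[K] N :=
  basisLift v

lemma chainLift_chainVector {N : Type*} [AddCommMonoid N] [Module K N]
    (v : OrderedSetPartition n → N) (F : OrderedSetPartition n) :
    chainLift χ p v (chainVector χ p F) = if p F.shape then v F else 0 :=
  basisLift_basisVector v F

/-- A linear map out of `ChainModule χ p` is a homomorphism of modules over the monoid algebra if it
is equivariant on the basis vectors. -/
noncomputable def chainHom {N : Type*} [AddCommMonoid N] [Module K N]
    [Module (MonoidAlgebra K (hsiaoMonoid n G)) N]
    [IsScalarTower K (MonoidAlgebra K (hsiaoMonoid n G)) N]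
    (φ : ChainModule χ p →ₗ[K] N)
    (h : ∀ m F, p F.shape →
      φ ((MonoidAlgebra.single m 1 : MonoidAlgebra K (hsiaoMonoid n G)) • chainVector χ p F) =
      (MonoidAlgebra.single m 1 : MonoidAlgebra K (hsiaoMonoid n G)) • φ (chainVector χ p F)) :
    ChainModule χ p →ₗ[MonoidAlgebra K (hsiaoMonoid n G)] N :=
  MonoidAlgebra.equivariantOfLinearOfComm φ fun m x =>
    LinearMap.congr_fun (chainModule_hom_ext
      (φ := φ ∘ₗ Module.toModuleEnd K (S := MonoidAlgebra K (hsiaoMonoid n G)) _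
        (MonoidAlgebra.single m 1))
      (ψ := Module.toModuleEnd K (S := MonoidAlgebra K (hsiaoMonoid n G)) _
        (MonoidAlgebra.single m 1) ∘ₗ φ) (h m)) x

lemma chainHom_apply {N : Type*} [AddCommMonoid N] [Module K N]
    [Module (MonoidAlgebra K (hsiaoMonoid n G)) N]
    [IsScalarTower K (MonoidAlgebra K (hsiaoMonoid n G)) N]
    (φ : ChainModule χ p →ₗ[K] N) (h) (x) : chainHom χ p φ h x = φ x := rfl

/-- The boundary of an ordered set partition: the signed sum of the ordered set partitions obtained
by splitting a block in two. -/
noncomputable def boundarySum (p' : SetPartition n → Prop) (F : OrderedSetPartition n) :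
    ChainModule χ p' :=
  ∑ P ∈ F.shape.parts, ∑ A ∈ P.ssubsets.erase ∅,
    BlockList.splitSign K F.shape.parts P A • chainVector χ p' (F.split P A)

/-- For `F` finer than `m`, action and splitting commute and the signs are unchanged, as they depend
on the shape only. Otherwise the action kills `F`, while some splittings of `F` may be finer than
`m`; these cancel in pairs. -/
lemma smul_boundarySum (p' : SetPartition n → Prop) (m : hsiaoMonoid n G)
    (F : OrderedSetPartition n) :
    (MonoidAlgebra.single m 1 : MonoidAlgebra K (hsiaoMonoid n G)) • boundarySum χ p' F =
      if F.shape ≤ m.1.1.shape then χ m • boundarySum χ p' (m.1.1 * F) else 0 := by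
  unfold boundarySum
  simp only [Finset.smul_sum, smul_comm (MonoidAlgebra.single m (1 : K))
    (BlockList.splitSign K _ _ _), single_smul_chainVector]
  split_ifs with h
  · rw [shape_mul_of_le h]
    refine Finset.sum_congr rfl fun P hP => Finset.sum_congr rfl fun A hA => ?_
    rw [Finset.mem_erase, Finset.mem_ssubsets, ← Finset.nonempty_iff_ne_empty] at hA
    rw [if_pos ((shape_split_le F hA.1 hA.2 (mem_parts_shape.1 hP)).trans h),
      mul_split h hA.1 hA.2, smul_comm]
  -- The pairing is `A ↔ P \ A`: the products agree by `mul_split_sdiff`, and the signs are opposite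
  -- by `splitSign_compl`.
  · refine Finset.sum_eq_zero fun P hP => Finset.sum_involution (fun A _ => P \ A) ?_ ?_ ?_ ?_
    · intro A hA
      rw [Finset.mem_erase, Finset.mem_ssubsets, ← Finset.nonempty_iff_ne_empty] at hA
      have hP := mem_parts_shape.1 hP
      rw [shape_split_sdiff F hA.1 hA.2 hP, BlockList.splitSign_compl hA.2 hA.1]
      split_ifs with hs
      · rw [mul_split_sdiff h hA.1 hA.2 hP hs, neg_smul, add_neg_cancel]
      · simp
    · intro A hA _ hAA
      rw [Finset.mem_erase, Finset.mem_ssubsets, ← Finset.nonempty_iff_ne_empty] at hA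
      have : Disjoint A A := by
        conv_lhs => rw [← hAA]
        exact Finset.sdiff_disjoint
      exact hA.1.ne_empty (Finset.disjoint_self_iff_empty _ |>.1 this)
    · intro A hA
      rw [Finset.mem_erase, Finset.mem_ssubsets, ← Finset.nonempty_iff_ne_empty] at hA ⊢
      exact ⟨Finset.sdiff_nonempty.2 hA.2.2, Finset.sdiff_ssubset hA.2.1 hA.1⟩
    · intro A hA
      rw [Finset.mem_erase, Finset.mem_ssubsets] at hA
      exact Finset.sdiff_sdiff_eq_self hA.2.1

/-- The boundary map. -/
noncomputable def boundaryMap (p' : SetPartition n → Prop) :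
    ChainModule χ p →ₗ[MonoidAlgebra K (hsiaoMonoid n G)] ChainModule χ p' :=
  chainHom χ p (chainLift χ p (boundarySum χ p')) fun m F hF => by
    rw [single_smul_chainVector, chainLift_chainVector, if_pos hF, smul_boundarySum]
    split_ifs with h
    · rw [map_smul, chainLift_chainVector, if_pos (by rwa [shape_mul_of_le h])]
    · simp

lemma boundaryMap_chainVector (p' : SetPartition n → Prop) {F : OrderedSetPartition n}
    (hF : p F.shape) : boundaryMap χ p p' (chainVector χ p F) = boundarySum χ p' F := by
  rw [boundaryMap, chainHom_apply, chainLift_chainVector, if_pos hF]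

end ChainModule

/-! ### Projectivity of the chain modules -/

section ChainProjective

open OrderedSetPartition
open scoped Classical

variable {n : ℕ} {K : Type u} [Field K] {G : Type v} [Group G]

lemma hsiaoOf_mul_mul (π : OrderedSetPartition n) (x : hsiaoMonoid n G) :
    hsiaoOf π * x * hsiaoOf π = hsiaoOf π * x := by
  refine hsiaoMonoid_ext (mul_eq_left_of_le ?_) (mul_one _)
  exact (shape_mul π x.1.1).trans_le inf_le_left

lemma single_hsiaoOf_mul_mul (π : OrderedSetPartition n)
    (a : MonoidAlgebra K (hsiaoMonoid n G)) :
    MonoidAlgebra.single (hsiaoOf π) 1 * a * MonoidAlgebra.single (hsiaoOf π) 1 =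
      MonoidAlgebra.single (hsiaoOf π) 1 * a := by
  induction a using MonoidAlgebra.induction_linear with
  | zero => simp
  | add a b ha hb => rw [mul_add, add_mul, ha, hb]
  | single x r => simp [MonoidAlgebra.single_mul_single, hsiaoOf_mul_mul]

/-- The product of the elements `1 - (π, 1)`, where `π` runs over a list. -/
noncomputable def killer (K : Type u) [Field K] (G : Type v) [Group G]
    (L : List (OrderedSetPartition n)) : MonoidAlgebra K (hsiaoMonoid n G) :=
  (L.map fun π => 1 - MonoidAlgebra.single (hsiaoOf π) 1).prod

/-- By `π x π = π x`, the factor `1 - π` is annihilated by everything of the form `π a`. The factors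
that precede it are absorbed into `a`, which is why `a` is arbitrary. -/
lemma single_mul_mul_killer {L : List (OrderedSetPartition n)} {π : OrderedSetPartition n}
    (hπ : π ∈ L) (a : MonoidAlgebra K (hsiaoMonoid n G)) :
    MonoidAlgebra.single (hsiaoOf π) 1 * a * killer K G L = 0 := by
  induction L generalizing a with
  | nil => simp at hπ
  | cons τ L ih =>
    have h : killer K G (τ :: L) = (1 - MonoidAlgebra.single (hsiaoOf τ) 1) * killer K G L := by
      simp [killer]
    rw [h]
    rcases List.mem_cons.1 hπ with rfl | hπ
    · rw [← mul_assoc, mul_sub, single_hsiaoOf_mul_mul, mul_one, sub_self, zero_mul]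
    · rw [← mul_assoc, mul_assoc _ a]
      exact ih hπ _

variable (χ : hsiaoMonoid n G →* K) (p : SetPartition n → Prop)

lemma killer_smul_chainVector {L : List (OrderedSetPartition n)} {F : OrderedSetPartition n}
    (h : ∀ π ∈ L, ¬ F.shape ≤ π.shape) :
    killer K G L • chainVector χ p F = chainVector χ p F := by
  induction L with
  | nil => simp [killer]
  | cons τ L ih =>
    have h1 : killer K G (τ :: L) = (1 - MonoidAlgebra.single (hsiaoOf τ) 1) * killer K G L := by
      simp [killer]
    have h2 : ¬ F.shape ≤ (hsiaoOf (G := G) τ).1.1.shape := h τ (by simp)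
    rw [h1, mul_smul, ih fun π hπ => h π (by simp [hπ]), sub_smul, one_smul,
      single_smul_chainVector, if_neg h2, sub_zero]

/-- The unnormalized projection to the `χ`-isotypic part for the subgroup of the `(F, g)`. -/
noncomputable def isotypicSum [Finite G] (F : OrderedSetPartition n) :
    MonoidAlgebra K (hsiaoMonoid n G) :=
  let _ := Fintype.ofFinite (blockSubgroup G F.shape)
  ∑ g : blockSubgroup G F.shape,
    MonoidAlgebra.single (hsiaoMk F g) (χ (hsiaoMk F g⁻¹))

lemma hsiaoMk_mul (F : OrderedSetPartition n) (g h : blockSubgroup G F.shape) :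
    hsiaoMk F g * hsiaoMk F h = hsiaoMk F (g * h) :=
  hsiaoMonoid_ext (mul_eq_left_of_le le_rfl) rfl

lemma single_mul_isotypicSum [Finite G] (F : OrderedSetPartition n)
    (g : blockSubgroup G F.shape) :
    MonoidAlgebra.single (hsiaoMk F g) 1 * isotypicSum χ F =
      χ (hsiaoMk F g) • isotypicSum χ F := by
  let _ := Fintype.ofFinite (blockSubgroup G F.shape)
  unfold isotypicSum
  rw [Finset.mul_sum, Finset.smul_sum]
  refine Fintype.sum_equiv (Equiv.mulLeft g : Equiv.Perm (blockSubgroup G F.shape)) _ _ fun h => ?_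
  rw [MonoidAlgebra.single_mul_single, hsiaoMk_mul, one_mul, MonoidAlgebra.smul_single,
    smul_eq_mul, mul_comm, ← map_mul, hsiaoMk_mul]
  simp

lemma isotypicSum_smul_chainVector [Finite G] {F : OrderedSetPartition n}
    (hχ : χ (hsiaoOf F) = 1) :
    isotypicSum χ F • chainVector χ p F =
      (Nat.card (blockSubgroup G F.shape) : K) • chainVector χ p F := by
  let _ := Fintype.ofFinite (blockSubgroup G F.shape)
  unfold isotypicSum
  rw [Finset.sum_smul]
  have h1 : ∀ g : blockSubgroup G F.shape,
      (MonoidAlgebra.single (hsiaoMk F g) (χ (hsiaoMk F g⁻¹)) :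
        MonoidAlgebra K (hsiaoMonoid n G)) • chainVector χ p F = chainVector χ p F := by
    intro g
    have h2 : (MonoidAlgebra.single (hsiaoMk F g) (χ (hsiaoMk F g⁻¹)) :
        MonoidAlgebra K (hsiaoMonoid n G)) =
        χ (hsiaoMk F g⁻¹) • MonoidAlgebra.single (hsiaoMk F g) 1 := by
      rw [MonoidAlgebra.smul_single, smul_eq_mul, mul_one]
    have h3 : F.shape ≤ (hsiaoMk F g).1.1.shape := le_rfl
    have h4 : (hsiaoMk F g).1.1 * F = F := mul_eq_left_of_le le_rfl
    rw [h2, smul_assoc, single_smul_chainVector, if_pos h3, h4, smul_smul, ← map_mul, hsiaoMk_mul,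
      inv_mul_cancel]
    change χ (hsiaoOf F) • _ = _
    rw [hχ, one_smul]
  rw [Finset.sum_congr rfl fun g _ => h1 g, Finset.sum_const, Nat.card_eq_fintype_card,
    Finset.card_univ, Nat.cast_smul_eq_nsmul]

/-- By Lagrange, the order of `G_Z` divides `|G| ^ n`. -/
lemma card_blockSubgroup_ne_zero [Finite G] (hchar : ¬ ringChar K ∣ Nat.card G)
    (Z : SetPartition n) : (Nat.card (blockSubgroup G Z) : K) ≠ 0 := by
  have h1 : Nat.card (blockSubgroup G Z) ∣ Nat.card G ^ n := by
    have := Subgroup.card_subgroup_dvd_card (blockSubgroup G Z)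
    simpa [Nat.card_fun] using this
  obtain ⟨c, hc⟩ := h1
  have h2 : (Nat.card G : K) ≠ 0 := fun h => hchar ((ringChar.spec K _).1 h)
  have h3 : ((Nat.card G ^ n : ℕ) : K) ≠ 0 := by
    rw [Nat.cast_pow]; exact pow_ne_zero _ h2
  rw [hc, Nat.cast_mul] at h3
  exact left_ne_zero_of_mul h3

/-- The first two properties are the relations satisfied by the basis vector `F`, and the third says
that `e` fixes it. Multiplying any preimage of `F` by `e` therefore gives a preimage with the same
relations. The element is the average over `G_Z`, `Z = F.shape`, times a product of factors `1 - π`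
over all `π` that are not coarser than `F`. -/
lemma exists_isotypic_element [Finite G] (hchar : ¬ ringChar K ∣ Nat.card G)
    (F : OrderedSetPartition n) (hχ : χ (hsiaoOf F) = 1) :
    ∃ e : MonoidAlgebra K (hsiaoMonoid n G),
      (∀ m : hsiaoMonoid n G, ¬ F.shape ≤ m.1.1.shape → MonoidAlgebra.single m 1 * e = 0) ∧
      (∀ g, MonoidAlgebra.single (hsiaoMk F g) 1 * e = χ (hsiaoMk F g) • e) ∧
      e • chainVector χ p F = chainVector χ p F := by
  let L : List (OrderedSetPartition n) :=
    (Set.toFinite {π : OrderedSetPartition n | ¬ F.shape ≤ π.shape}).toFinset.toList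
  have hL : ∀ π, π ∈ L ↔ ¬ F.shape ≤ π.shape := fun π => by simp [L]
  refine ⟨(Nat.card (blockSubgroup G F.shape) : K)⁻¹ • (isotypicSum χ F * killer K G L),
    fun m hm => ?_, fun g => ?_, ?_⟩
  · let _ := Fintype.ofFinite (blockSubgroup G F.shape)
    rw [mul_smul_comm, isotypicSum, ← mul_assoc, Finset.mul_sum, Finset.sum_mul]
    refine smul_eq_zero_of_right _ (Finset.sum_eq_zero fun g _ => ?_)
    -- The product begins with `m.1.1 * F`, whose shape is not coarser than that of `F`, so `killer`
    -- annihilates it.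
    have h1 : m * hsiaoMk F g = hsiaoOf (m.1.1 * F) * (m * hsiaoMk F g) :=
      hsiaoMonoid_ext (mul_eq_left_of_le le_rfl).symm (one_mul _).symm
    have h2 : (MonoidAlgebra.single m 1 * MonoidAlgebra.single (hsiaoMk F g)
        (χ (hsiaoMk F g⁻¹)) : MonoidAlgebra K (hsiaoMonoid n G)) =
        MonoidAlgebra.single (hsiaoOf (m.1.1 * F)) 1 *
          MonoidAlgebra.single (m * hsiaoMk F g) (χ (hsiaoMk F g⁻¹)) := by
      rw [MonoidAlgebra.single_mul_single, MonoidAlgebra.single_mul_single, ← h1]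
    rw [h2]
    refine single_mul_mul_killer ((hL _).2 fun h => hm ?_) _
    rw [shape_mul] at h
    exact h.trans inf_le_left
  · rw [mul_smul_comm, ← mul_assoc, single_mul_isotypicSum, smul_mul_assoc, smul_comm]
  · rw [smul_assoc, mul_smul, killer_smul_chainVector χ p fun π hπ => (hL π).1 hπ,
      isotypicSum_smul_chainVector χ p hχ, smul_smul,
      inv_mul_cancel₀ (card_blockSubgroup_ne_zero hchar _), one_smul]

/-- For each shape a base vector is lifted to `y` with the same relations as the vector. Every `F`
of that shape is `(F, 1)` times the base vector, so `F ↦ (F, 1) • y` is forced, and the relations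
make it equivariant. -/
lemma projective_chainModule [Finite G] (hchar : ¬ ringChar K ∣ Nat.card G)
    (hχ : ∀ F : OrderedSetPartition n, p F.shape → χ (hsiaoOf F) = 1) :
    Module.Projective (MonoidAlgebra K (hsiaoMonoid n G)) (ChainModule χ p) := by
  refine Module.Projective.of_lifting_property'' fun f hf => ?_
  choose base hbase using exists_shape_eq (n := n)
  have hχ' (Z : SetPartition n) (hZ : p Z) : χ (hsiaoOf (base Z)) = 1 :=
    hχ _ (by rwa [hbase])
  have h1 (Z : SetPartition n) : ∃ y : ChainModule χ p →₀ MonoidAlgebra K (hsiaoMonoid n G), p Z →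
      (∀ m : hsiaoMonoid n G, ¬ Z ≤ m.1.1.shape →
        (MonoidAlgebra.single m 1 : MonoidAlgebra K (hsiaoMonoid n G)) • y = 0) ∧
      (∀ g, (MonoidAlgebra.single (hsiaoMk (base Z) g) 1 :
        MonoidAlgebra K (hsiaoMonoid n G)) • y = χ (hsiaoMk (base Z) g) • y) ∧
      f y = chainVector χ p (base Z) := by
    by_cases hZ : p Z
    · obtain ⟨e, he1, he2, he3⟩ := exists_isotypic_element χ p hchar (base Z) (hχ' Z hZ)
      obtain ⟨y, hy⟩ := hf (chainVector χ p (base Z))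
      refine ⟨e • y, fun _ => ⟨fun m hm => ?_, fun g => ?_, ?_⟩⟩
      · rw [smul_smul, he1 m (by rwa [hbase]), zero_smul]
      · rw [smul_smul, he2, smul_assoc]
      · rw [map_smul, hy, he3]
    · exact ⟨0, fun h => absurd h hZ⟩
  choose y hy using h1
  refine ⟨chainHom χ p (chainLift χ p (N := ChainModule χ p →₀ MonoidAlgebra K (hsiaoMonoid n G)) fun F =>
    (MonoidAlgebra.single (hsiaoOf F) 1 : MonoidAlgebra K (hsiaoMonoid n G)) • y F.shape)
    fun m F hF => ?_, ?_⟩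
  · obtain ⟨hy1, hy2, -⟩ := hy _ hF
    rw [single_smul_chainVector, chainLift_chainVector, if_pos hF, smul_smul,
      MonoidAlgebra.single_mul_single, mul_one]
    split_ifs with h
    · have hbm : (base F.shape).shape ≤ m.1.1.shape := by rwa [hbase]
      rw [map_smul, chainLift_chainVector, shape_mul_of_le h, if_pos hF]
      let g : blockSubgroup G (base F.shape).shape := ⟨m.1.2, blockSubgroup_anti hbm m.2⟩
      -- The group component of `m` is moved to the right, next to `y`, where it acts by a scalar;
      -- `h4` identifies that scalar with `χ m`.
      have h2 : m * hsiaoOf F = hsiaoOf (m.1.1 * F) * hsiaoMk (base F.shape) g := by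
        refine hsiaoMonoid_ext ?_ ?_
        · refine (mul_eq_left_of_le (F := m.1.1 * F) (b := base F.shape) ?_).symm
          rw [shape_mul_of_le h, hbase]
        · exact (mul_one m.1.2).trans (one_mul m.1.2).symm
      have h3 : hsiaoMk (base F.shape) g = hsiaoOf (base F.shape) * m :=
        hsiaoMonoid_ext (mul_eq_left_of_le hbm).symm (one_mul m.1.2).symm
      have h4 : χ (hsiaoMk (base F.shape) g) = χ m := by
        rw [h3, map_mul, hχ' _ hF, one_mul]
      rw [h2, ← mul_one (1 : K), ← MonoidAlgebra.single_mul_single, mul_smul, hy2, h4, mul_one,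
        smul_comm]
    · rw [map_zero, eq_comm]
      refine hy1 _ fun h' => h ?_
      exact (h'.trans_eq (shape_mul m.1.1 F)).trans inf_le_left
  · refine chainModule_linearMap_ext χ p fun F hF => ?_
    obtain ⟨-, -, hy3⟩ := hy _ hF
    have h3 : (base F.shape).shape ≤ (hsiaoOf (G := G) F).1.1.shape := (hbase _).le
    have h4 : (hsiaoOf (G := G) F).1.1 * base F.shape = F := mul_eq_left_of_le (hbase _).ge
    rw [LinearMap.comp_apply, chainHom_apply, chainLift_chainVector, if_pos hF, map_smul, hy3,
      single_smul_chainVector, if_pos h3, h4, hχ F hF, one_smul]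
    rfl

end ChainProjective

/-! ### Restriction of block characters to smaller block subgroups -/

section BlockCharacter

variable {n : ℕ} {K : Type u} [Field K] {G : Type v} [Group G]

lemma blockCharacter_apply (X : SetPartition n) (f : X.parts → (G →* Kˣ))
    (g : blockSubgroup G X) : blockCharacter X f g = ∏ P, f P (blockValue X P g) := by
  simp [blockCharacter, MonoidHom.finsetProd_apply]

/-- An element of `G_Y` is constant on each block of `Y`, so the factors of the blocks of `X` inside
one block `P` are evaluated at the same group element. This is the origin of the product condition
on `h`. -/
lemma blockCharacter_of_le {X Y : SetPartition n} (hXY : X ≤ Y) (f : X.parts → (G →* Kˣ))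
    (g : blockSubgroup G Y) :
    blockCharacter X f ⟨g.1, blockSubgroup_anti hXY g.2⟩ =
      blockCharacter Y (fun P => ∏ Q : X.parts with Q.1 ⊆ P.1, f Q) g := by
  rw [blockCharacter_apply, blockCharacter_apply]
  simp only [MonoidHom.finsetProd_apply, Finset.prod_filter]
  rw [Finset.prod_comm]
  refine Finset.prod_congr rfl fun Q _ => ?_
  obtain ⟨P, hP, hQP⟩ := hXY Q.2
  obtain ⟨i, hi⟩ := X.nonempty_of_mem_parts Q.2
  rw [Finset.prod_eq_single ⟨P, hP⟩, if_pos hQP, blockValue_eq X Q _ hi,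
    blockValue_eq Y ⟨P, hP⟩ g (hQP hi)]
  · intro R _ hR
    rw [if_neg fun hQR => hR (Subtype.ext (Y.eq_of_mem_parts R.2 hP (hQR hi) (hQP hi))),
      MonoidHom.one_apply]
  · simp

lemma blockCharacter_injective (Y : SetPartition n) :
    Function.Injective (blockCharacter Y : (Y.parts → (G →* Kˣ)) → _) := by
  intro h h' hh
  funext P
  ext a : 1
  -- The function equal to `a` on `P` and to `1` elsewhere isolates the factor of `P`.
  let g : blockSubgroup G Y := ⟨fun i => if i ∈ P.1 then a else 1, by
    intro Q hQ i hi j hj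
    by_cases hQP : Q = P.1
    · simp [← hQP, hi, hj]
    · have hd : Disjoint Q P.1 := Y.disjoint hQ P.2 hQP
      beta_reduce
      rw [if_neg (Finset.disjoint_left.1 hd hi), if_neg (Finset.disjoint_left.1 hd hj)]⟩
  have hg : ∀ k : Y.parts → (G →* Kˣ), blockCharacter Y k g = k P a := by
    intro k
    rw [blockCharacter_apply, Finset.prod_eq_single P]
    · obtain ⟨i, hi⟩ := Y.nonempty_of_mem_parts P.2
      rw [blockValue_eq Y P g hi]
      exact congrArg (k P) (if_pos hi)
    · intro Q _ hQ
      obtain ⟨i, hi⟩ := Y.nonempty_of_mem_parts Q.2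
      have hd : Disjoint Q.1 P.1 := Y.disjoint Q.2 P.2 fun h => hQ (Subtype.ext h)
      rw [blockValue_eq Y Q g hi]
      exact (congrArg (k Q) (if_neg (Finset.disjoint_left.1 hd hi))).trans (map_one _)
    · simp
  rw [← hg h, ← hg h', hh]

lemma inflatedCharacter_of_le {X : SetPartition n} (f : X.parts → (G →* Kˣ))
    {m : hsiaoMonoid n G} (h : X ≤ m.1.1.shape) : inflatedCharacter X f m =
      (blockCharacter X f ⟨m.1.2, blockSubgroup_anti h (mem_hsiaoMonoid.1 m.2)⟩ : K) :=
  dif_pos h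

lemma inflatedCharacter_of_not_le {X : SetPartition n} (f : X.parts → (G →* Kˣ))
    {m : hsiaoMonoid n G} (h : ¬ X ≤ m.1.1.shape) : inflatedCharacter X f m = 0 :=
  dif_neg h

lemma inflatedCharacter_hsiaoOf {X : SetPartition n} (f : X.parts → (G →* Kˣ))
    {F : OrderedSetPartition n} (h : X ≤ F.shape) : inflatedCharacter X f (hsiaoOf F) = 1 := by
  have h' : X ≤ (hsiaoOf (G := G) F).1.1.shape := h
  rw [inflatedCharacter_of_le f h']
  exact congrArg Units.val (map_one (blockCharacter X f))

end BlockCharacter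

/-! ### Homomorphisms from chain modules to simple modules -/

section HomSimple

open OrderedSetPartition
open scoped Classical

variable {n : ℕ} {K : Type u} [Field K] {G : Type v} [Group G]

noncomputable instance (X : SetPartition n) (f : X.parts → (G →* Kˣ)) :
    Module K (HsiaoSimple X f) := inferInstanceAs (Module K K)

instance (X : SetPartition n) (f : X.parts → (G →* Kˣ)) :
    IsScalarTower K (MonoidAlgebra K (hsiaoMonoid n G)) (HsiaoSimple X f) where
  smul_assoc a x y := by
    change MonoidAlgebra.lift K K (hsiaoMonoid n G) (inflatedCharacter X f) (a • x) * (id y : K) =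
      a * (MonoidAlgebra.lift K K (hsiaoMonoid n G) (inflatedCharacter X f) x * (id y : K))
    rw [map_smul, smul_eq_mul, mul_assoc]

lemma single_smul_hsiaoSimple (X : SetPartition n) (f : X.parts → (G →* Kˣ))
    (m : hsiaoMonoid n G) (x : HsiaoSimple X f) :
    (MonoidAlgebra.single m 1 : MonoidAlgebra K (hsiaoMonoid n G)) • x =
      inflatedCharacter X f m • x := by
  change MonoidAlgebra.lift K K (hsiaoMonoid n G) (inflatedCharacter X f)
    (MonoidAlgebra.single m 1) * (id x : K) = inflatedCharacter X f m * (id x : K)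
  rw [MonoidAlgebra.lift_single, one_smul]

variable (χ : hsiaoMonoid n G →* K) (p : SetPartition n → Prop) (Y : SetPartition n)
  (h : Y.parts → (G →* Kˣ))

variable {χ p Y h} in
lemma hom_hsiaoSimple_smul (φ : ChainModule χ p →ₗ[MonoidAlgebra K (hsiaoMonoid n G)]
      HsiaoSimple Y h) (m : hsiaoMonoid n G) (F : OrderedSetPartition n) :
    inflatedCharacter Y h m • φ (chainVector χ p F) =
      if F.shape ≤ m.1.1.shape then χ m • φ (chainVector χ p (m.1.1 * F)) else 0 := by
  rw [← single_smul_hsiaoSimple, ← map_smul, single_smul_chainVector]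
  split_ifs
  · exact LinearMap.map_smul_of_tower φ _ _
  · exact map_zero φ

-- The elements `(F, g)` act on `F` by `χ`, so the two characters agree on them; at `g = 1` the
-- value is `1`, which forces `Y ≤ F.shape`. Conversely, an `E` of shape `Y` acts as the identity on
-- the target, so it cannot kill `F`, and `F.shape ≤ Y`.
variable {χ p Y h} in
lemma shape_eq_of_hom_ne_zero (hχ : ∀ F : OrderedSetPartition n, p F.shape → χ (hsiaoOf F) = 1)
    (φ : ChainModule χ p →ₗ[MonoidAlgebra K (hsiaoMonoid n G)] HsiaoSimple Y h)
    {F : OrderedSetPartition n} (hF : p F.shape) (hφ : φ (chainVector χ p F) ≠ 0) :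
    F.shape = Y ∧ ∀ g, χ (hsiaoMk F g) = inflatedCharacter Y h (hsiaoMk F g) := by
  have h1 : ∀ g, χ (hsiaoMk F g) = inflatedCharacter Y h (hsiaoMk F g) := by
    intro g
    have key := hom_hsiaoSimple_smul φ (hsiaoMk F g) F
    have h3 : F.shape ≤ (hsiaoMk F g).1.1.shape := le_rfl
    have h4 : (hsiaoMk F g).1.1 * F = F := mul_eq_left_of_le le_rfl
    rw [if_pos h3, h4] at key
    exact (smul_left_injective K hφ key).symm
  refine ⟨?_, h1⟩
  have h2 : Y ≤ F.shape := by
    by_contra hY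
    have hY' : ¬ Y ≤ (hsiaoOf (G := G) F).1.1.shape := hY
    have := h1 1
    change χ (hsiaoOf F) = inflatedCharacter Y h (hsiaoOf F) at this
    rw [hχ F hF, inflatedCharacter_of_not_le h hY'] at this
    exact one_ne_zero this
  refine le_antisymm ?_ h2
  obtain ⟨E, rfl⟩ := exists_shape_eq Y
  by_contra hE
  have key := hom_hsiaoSimple_smul φ (hsiaoOf E) F
  have hE' : ¬ F.shape ≤ (hsiaoOf (G := G) E).1.1.shape := hE
  rw [if_neg hE', inflatedCharacter_hsiaoOf h le_rfl, one_smul] at key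
  exact hφ key

-- Since `E * F = E`, the element `(E, 1)` carries `F` to `E`, and it acts as the identity on the
-- target.
variable {χ p Y h} in
lemma hom_chainVector_eq (hχ : ∀ F : OrderedSetPartition n, p F.shape → χ (hsiaoOf F) = 1)
    (φ : ChainModule χ p →ₗ[MonoidAlgebra K (hsiaoMonoid n G)] HsiaoSimple Y h)
    {E F : OrderedSetPartition n} (hE : E.shape = Y) (hF : F.shape = Y) (hY : p Y) :
    φ (chainVector χ p E) = φ (chainVector χ p F) := by
  have key := hom_hsiaoSimple_smul φ (hsiaoOf E) F
  have h3 : F.shape ≤ (hsiaoOf (G := G) E).1.1.shape := (hF.trans hE.symm).le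
  have h4 : (hsiaoOf (G := G) E).1.1 * F = E := mul_eq_left_of_le (hE.trans hF.symm).le
  rw [if_pos h3, h4, hχ E (by rwa [hE]), inflatedCharacter_hsiaoOf h hE.ge, one_smul,
    one_smul] at key
  exact key.symm

/-- The homomorphism that sends the ordered set partitions with underlying set partition `Y` to `t`,
and the others to zero. -/
noncomputable def simpleHom (hm : ∀ m : hsiaoMonoid n G, Y ≤ m.1.1.shape →
      χ m = inflatedCharacter Y h m) (t : HsiaoSimple Y h) :
    ChainModule χ p →ₗ[MonoidAlgebra K (hsiaoMonoid n G)] HsiaoSimple Y h :=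
  chainHom χ p (chainLift χ p fun F => if F.shape = Y then t else 0) fun m F hF => by
    rw [single_smul_chainVector, chainLift_chainVector, if_pos hF, single_smul_hsiaoSimple]
    by_cases hFm : F.shape ≤ m.1.1.shape
    · rw [if_pos hFm, map_smul, chainLift_chainVector, shape_mul_of_le hFm, if_pos hF]
      split_ifs with hFY
      · rw [hm m (hFY ▸ hFm)]
      · rw [smul_zero, smul_zero]
    · rw [if_neg hFm, map_zero]
      split_ifs with hFY
      · rw [inflatedCharacter_of_not_le h (hFY ▸ hFm), zero_smul]
      · rw [smul_zero]

lemma simpleHom_chainVector (hm : ∀ m : hsiaoMonoid n G, Y ≤ m.1.1.shape →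
      χ m = inflatedCharacter Y h m) (t : HsiaoSimple Y h) {F : OrderedSetPartition n}
    (hF : p F.shape) :
    simpleHom χ p Y h hm t (chainVector χ p F) = if F.shape = Y then t else 0 := by
  rw [simpleHom, chainHom_apply, chainLift_chainVector, if_pos hF]

end HomSimple

/-! ### Exactness of the resolution -/

section Exactness

open OrderedSetPartition BlockList
open scoped Classical

variable {n : ℕ} {K : Type u} [Field K] {G : Type v} [Group G]

/-- The identification of a chain module with the space of finitely supported functions. -/
noncomputable def chainCoeff (χ : hsiaoMonoid n G →* K) (p : SetPartition n → Prop) :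
    ChainModule χ p ≃ₗ[K] (ShapedPartition p →₀ K) :=
  LinearEquiv.refl K _

/-- The coefficients of a chain, twisted by signs, as a function on lists of blocks. -/
noncomputable def listCoeff {χ : hsiaoMonoid n G →* K} {p : SetPartition n → Prop}
    (c : ChainModule χ p) (L : List (Finset (Fin n))) : K :=
  sign K L * Finsupp.mapDomain (fun F : ShapedPartition p => F.1.blocks) (chainCoeff χ p c) L

variable {χ : hsiaoMonoid n G →* K} {p p' : SetPartition n → Prop}

lemma listCoeff_blocks (c : ChainModule χ p) (F : ShapedPartition p) :
    listCoeff c F.1.blocks = sign K F.1.blocks * chainCoeff χ p c F := by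
  rw [listCoeff, Finsupp.mapDomain_apply (f := fun F : ShapedPartition p => F.1.blocks)
    (blocks_injective.comp Subtype.val_injective)]

lemma listCoeff_of_forall_ne (c : ChainModule χ p) {L : List (Finset (Fin n))}
    (hL : ∀ F : OrderedSetPartition n, p F.shape → F.blocks ≠ L) : listCoeff c L = 0 := by
  rw [listCoeff, Finsupp.mapDomain_of_notMem_range, mul_zero]
  rintro ⟨F, rfl⟩
  exact hL F.1 F.2 rfl

lemma listCoeff_zero (L : List (Finset (Fin n))) :
    listCoeff (0 : ChainModule χ p) L = 0 := by
  simp [listCoeff]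

lemma listCoeff_add (c c' : ChainModule χ p) (L : List (Finset (Fin n))) :
    listCoeff (c + c') L = listCoeff c L + listCoeff c' L := by
  simp [listCoeff, Finsupp.mapDomain_add, mul_add]

lemma listCoeff_smul (a : K) (c : ChainModule χ p) (L : List (Finset (Fin n))) :
    listCoeff (a • c) L = a * listCoeff c L := by
  simp [listCoeff, Finsupp.mapDomain_smul, mul_left_comm]

lemma listCoeff_chainVector {F : OrderedSetPartition n} (hF : p F.shape)
    (L : List (Finset (Fin n))) :
    listCoeff (chainVector χ p F) L = sign K L * if L = F.blocks then 1 else 0 := by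
  have h1 : chainCoeff χ p (chainVector χ p F) = Finsupp.single ⟨F, hF⟩ 1 := basisVector_val ⟨F, hF⟩
  rw [listCoeff, h1, Finsupp.mapDomain_single, Finsupp.single_apply]
  simp only [eq_comm]

lemma chain_induction {motive : ChainModule χ p → Prop} (c : ChainModule χ p)
    (zero : motive 0) (add : ∀ c c', motive c → motive c' → motive (c + c'))
    (smul : ∀ (a : K) F, p F.shape → motive (a • chainVector χ p F)) : motive c := by
  refine Finsupp.induction_linear (motive := motive) (chainCoeff χ p c) zero (fun c c' => add c c')
    fun F a => ?_
  have h1 : Finsupp.single F a = a • basisVector K p F.1 := by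
    rw [basisVector_val, Finsupp.smul_single, smul_eq_mul, mul_one]
  exact h1 ▸ smul a F.1 F.2

/-- By linearity this reduces to one basis vector, where `sign_mul_coboundary_single` turns the
splittings of `F` into merges of `E`. -/
lemma chainCoeff_boundaryMap (c : ChainModule χ p) (E : ShapedPartition p') :
    chainCoeff χ p' (boundaryMap χ p p' c) E =
      sign K E.1.blocks * coboundary E.1.blocks (listCoeff c) := by
  induction c using chain_induction with
  | zero =>
    have : listCoeff (0 : ChainModule χ p) = fun _ => 0 := funext listCoeff_zero
    simp [this, coboundary_zero]
  | add c c' hc hc' =>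
    have : listCoeff (c + c') = fun L => listCoeff c L + listCoeff c' L :=
      funext (listCoeff_add c c')
    rw [map_add, map_add, Finsupp.add_apply, hc, hc', this, coboundary_add, mul_add]
  | smul a F hF =>
    have : listCoeff (a • chainVector χ p F) =
        fun L => a * (sign K L * if L = F.blocks then 1 else 0) :=
      funext fun L => by rw [listCoeff_smul, listCoeff_chainVector hF]
    rw [LinearMap.map_smul_of_tower, boundaryMap_chainVector χ p p' hF, map_smul,
      Finsupp.smul_apply, this, coboundary_mul, mul_left_comm,
      sign_mul_coboundary_single F.isDisjoint_blocks E.1.isDisjoint_blocks, smul_eq_mul,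
      boundarySum, map_sum, Finsupp.finsetSum_apply]
    congr 1
    refine Finset.sum_congr rfl fun P hP => ?_
    rw [map_sum, Finsupp.finsetSum_apply]
    refine Finset.sum_congr rfl fun A hA => ?_
    rw [Finset.mem_erase, Finset.mem_ssubsets, ← Finset.nonempty_iff_ne_empty] at hA
    rw [map_smul, Finsupp.smul_apply, smul_eq_mul, ← blocks_split F hA.1 hA.2]
    exact congrArg _ (basisVector_apply _ E)

lemma isDisjoint_toList (X : SetPartition n) : IsDisjoint X.parts.toList := by
  obtain ⟨F, hF⟩ : ∃ F : OrderedSetPartition n, F.blocks.Perm X.parts.toList := by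
    obtain ⟨F, rfl⟩ := exists_shape_eq X
    exact ⟨F, (List.toFinset_toList F.isDisjoint_blocks.nodup).symm⟩
  exact ⟨(hF.pairwise_iff fun h => h.symm).1 F.disjoint,
    fun P hP => F.nonempty P (hF.mem_iff.2 hP)⟩

lemma isOrderedPartition_blocks {X : SetPartition n} {F : OrderedSetPartition n}
    (h : X ≤ F.shape) : IsOrderedPartition X.parts.toList F.blocks where
  toAnd := F.isDisjoint_blocks
  exists_le x hx := by
    obtain ⟨P, hP, hxP⟩ := h (Finset.mem_toList.1 hx)
    exact ⟨P, mem_parts_shape.1 hP, hxP⟩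
  cover P _ i _ := by
    obtain ⟨x, hx, hi⟩ := X.exists_mem (Finset.mem_univ i)
    exact ⟨x, Finset.mem_toList.2 hx, hi⟩

lemma BlockList.IsOrderedPartition.exists_blocks_eq {X : SetPartition n} {L : List (Finset (Fin n))}
    (h : IsOrderedPartition X.parts.toList L) :
    ∃ F : OrderedSetPartition n, F.blocks = L ∧ X ≤ F.shape := by
  refine ⟨⟨L, h.right, h.left, fun i => ?_⟩, rfl, fun x hx => ?_⟩
  · obtain ⟨x, hx, hi⟩ := X.exists_mem (Finset.mem_univ i)
    obtain ⟨P, hP, hxP⟩ := h.exists_le x (Finset.mem_toList.2 hx)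
    exact ⟨P, hP, hxP hi⟩
  · obtain ⟨P, hP, hxP⟩ := h.exists_le x (Finset.mem_toList.2 hx)
    exact ⟨P, mem_parts_shape.2 hP, hxP⟩

/-- The set partitions that are coarser than `X` and have `k` blocks less. -/
def IsCoarsening (X : SetPartition n) (k : ℕ) (Z : SetPartition n) : Prop :=
  X ≤ Z ∧ Z.parts.card + k = X.parts.card

variable {X : SetPartition n} {k : ℕ}

/-- Sending a block of `X` to the block of `Z` containing it is surjective, hence injective by
cardinality, so no two blocks of `X` are merged in `Z`. -/
lemma IsCoarsening.eq {Z : SetPartition n} (h : IsCoarsening X 0 Z) : Z = X := by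
  obtain ⟨hle, hcard⟩ := h
  have hex : ∀ x ∈ X.parts, ∃ P ∈ Z.parts, x ⊆ P := fun x hx => hle hx
  choose! φ hφ hφ' using hex
  have hsurj : Set.SurjOn φ X.parts Z.parts := by
    intro P hP
    obtain ⟨i, hi⟩ := Z.nonempty_of_mem_parts hP
    obtain ⟨x, hx, hix⟩ := X.exists_mem (Finset.mem_univ i)
    exact ⟨x, hx, Z.eq_of_mem_parts (hφ x hx) hP (hφ' x hx hix) hi⟩
  have hinj : Set.InjOn φ X.parts := Finset.injOn_of_surjOn_of_card_le φ hφ hsurj (by omega)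
  refine le_antisymm (fun P hP => ?_) hle
  obtain ⟨x, hx, rfl⟩ := hsurj hP
  refine ⟨x, hx, fun i hi => ?_⟩
  obtain ⟨y, hy, hiy⟩ := X.exists_mem (Finset.mem_univ i)
  rwa [← hinj hy hx (Z.eq_of_mem_parts (hφ y hy) (hφ x hx) (hφ' y hy hiy) hi)]

lemma BlockList.IsOrderedPartition.exists_isCoarsening {L : List (Finset (Fin n))}
    (h : IsOrderedPartition X.parts.toList L) (hk : L.length + k = X.parts.card) :
    ∃ F : ShapedPartition (IsCoarsening X k), F.1.blocks = L := by
  obtain ⟨F, rfl, hF⟩ := h.exists_blocks_eq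
  exact ⟨⟨F, hF, by rwa [card_parts_shape]⟩, rfl⟩

lemma listCoeff_of_length_ne (c : ChainModule χ (IsCoarsening X k)) {L : List (Finset (Fin n))}
    (hL : L.length + k ≠ X.parts.card) : listCoeff c L = 0 :=
  listCoeff_of_forall_ne c fun F hF h => hL <| by
    rw [← h, ← card_parts_shape]; exact hF.2

/-- The shift by one arises because `coboundary` at `L` evaluates at lists one shorter than `L`. -/
lemma coboundary_listCoeff_of_length_ne (c : ChainModule χ (IsCoarsening X k))
    {L : List (Finset (Fin n))} (hL : L.length + k ≠ X.parts.card + 1) :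
    coboundary L (listCoeff c) = 0 := by
  refine coboundary_eq_zero fun L₁ P Q L₂ h => listCoeff_of_length_ne c fun h' => hL ?_
  rw [h, ← h']
  simp only [List.length_append, List.length_cons]
  omega

lemma listCoeff_boundaryMap (c : ChainModule χ p) {L : List (Finset (Fin n))}
    (h : IsOrderedPartition X.parts.toList L) (hk : L.length + k = X.parts.card) :
    listCoeff (boundaryMap χ p (IsCoarsening X k) c) L = coboundary L (listCoeff c) := by
  obtain ⟨F, rfl⟩ := h.exists_isCoarsening hk
  rw [listCoeff_blocks, chainCoeff_boundaryMap, ← mul_assoc, sign_mul_sign, one_mul]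

/-- The primitive `c'` is a function on lists of all lengths. Only its values in degree `k + 1` are
kept: a merge of a list of degree `k` has that degree, so the other values do not enter. -/
lemma exists_boundaryMap_eq (c : ChainModule χ (IsCoarsening X k))
    (hc : ∀ L, IsOrderedPartition X.parts.toList L → coboundary L (listCoeff c) = 0)
    (h0 : orderSum X.parts.toList (listCoeff c) = 0) :
    ∃ b, boundaryMap χ (IsCoarsening X (k + 1)) (IsCoarsening X k) b = c := by
  obtain ⟨c', hc'⟩ := exists_coboundary_eq _ (isDisjoint_toList X) _ hc h0
  let b : ChainModule χ (IsCoarsening X (k + 1)) := (chainCoeff χ _).symm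
    (Finsupp.equivFunOnFinite.symm fun E => sign K E.1.blocks * c' E.1.blocks)
  have hb : ∀ L, IsOrderedPartition X.parts.toList L → L.length + (k + 1) = X.parts.card →
      listCoeff b L = c' L := by
    intro L hL hk
    obtain ⟨F, rfl⟩ := hL.exists_isCoarsening hk
    rw [listCoeff_blocks, LinearEquiv.apply_symm_apply, Finsupp.equivFunOnFinite_symm_apply_apply,
      ← mul_assoc, sign_mul_sign, one_mul]
  refine ⟨b, (chainCoeff χ _).injective (Finsupp.ext fun E => ?_)⟩
  have hE := isOrderedPartition_blocks E.2.1
  have h1 : coboundary E.1.blocks (listCoeff b) = coboundary E.1.blocks c' := by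
    rw [← sub_eq_zero, ← coboundary_sub]
    refine coboundary_eq_zero fun L₁ P Q L₂ h => sub_eq_zero.2 (hb _ ?_ ?_)
    · rw [h] at hE; exact hE.merge
    · have := E.2.2
      rw [card_parts_shape, h] at this
      rw [← this]
      simp only [List.length_append, List.length_cons]
      omega
  rw [chainCoeff_boundaryMap, h1, ← hc' _ hE, listCoeff_blocks, ← mul_assoc, sign_mul_sign, one_mul]

lemma exact_boundaryMap : Function.Exact
    (boundaryMap χ (IsCoarsening X (k + 2)) (IsCoarsening X (k + 1)))
    (boundaryMap χ (IsCoarsening X (k + 1)) (IsCoarsening X k)) := by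
  intro c
  constructor
  · intro hc
    refine exists_boundaryMap_eq c (fun L hL => ?_) (orderSum_eq_zero fun M hM => ?_)
    · by_cases hk : L.length + k = X.parts.card
      · rw [← listCoeff_boundaryMap c hL hk, hc, listCoeff_zero]
      · exact coboundary_listCoeff_of_length_ne c (by omega)
    -- Orderings of `X` have degree zero, whereas `c` lives in degree `k + 1`.
    · refine listCoeff_of_length_ne c ?_
      rw [hM.length_eq, Finset.length_toList]
      omega
  · rintro ⟨b, rfl⟩
    refine (chainCoeff χ _).injective (Finsupp.ext fun E => ?_)
    have hE := isOrderedPartition_blocks E.2.1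
    have h1 : coboundary E.1.blocks (listCoeff
        (boundaryMap χ (IsCoarsening X (k + 2)) (IsCoarsening X (k + 1)) b)) =
        coboundary E.1.blocks fun M => coboundary M (listCoeff b) := by
      rw [← sub_eq_zero, ← coboundary_sub]
      refine coboundary_eq_zero fun L₁ P Q L₂ h => sub_eq_zero.2 (listCoeff_boundaryMap b ?_ ?_)
      · rw [h] at hE; exact hE.merge
      · have := E.2.2
        rw [card_parts_shape, h] at this
        rw [← this]
        simp only [List.length_append, List.length_cons]
        omega
    rw [chainCoeff_boundaryMap, h1, coboundary_coboundary, mul_zero, map_zero, Finsupp.zero_apply]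

variable (f : X.parts → (G →* Kˣ))

/-- The generator of the simple module `(X, f)`. -/
def hsiaoOne : HsiaoSimple X f := (1 : K)

/-- The augmentation of the resolution. -/
noncomputable def augmentation : ChainModule (inflatedCharacter X f) (IsCoarsening X 0)
    →ₗ[MonoidAlgebra K (hsiaoMonoid n G)] HsiaoSimple X f :=
  simpleHom _ _ X f (fun _ _ => rfl) (hsiaoOne f)

lemma augmentation_chainVector {F : OrderedSetPartition n} (hF : IsCoarsening X 0 F.shape) :
    augmentation f (chainVector _ _ F) = hsiaoOne f := by
  rw [augmentation, simpleHom_chainVector _ _ _ _ _ _ hF, if_pos hF.eq]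

/-- Up to a global sign, the obstruction `orderSum` of `exists_coboundary_eq` is the augmentation.
-/
lemma orderSum_listCoeff (c : ChainModule (inflatedCharacter X f) (IsCoarsening X 0)) :
    orderSum X.parts.toList (listCoeff c) =
      sign K X.parts.toList * (id (augmentation f c) : K) := by
  induction c using chain_induction with
  | zero =>
    have : listCoeff (0 : ChainModule (inflatedCharacter X f) (IsCoarsening X 0)) = fun _ => 0 :=
      funext listCoeff_zero
    rw [this, orderSum_eq_zero fun _ _ => rfl, map_zero]
    exact (mul_zero (sign K X.parts.toList)).symm
  | add c c' hc hc' =>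
    have : listCoeff (c + c') = fun L => listCoeff c L + listCoeff c' L :=
      funext (listCoeff_add c c')
    rw [this, orderSum_add, hc, hc', map_add]
    exact (mul_add (sign K X.parts.toList) _ _).symm
  | smul a F hF =>
    have : listCoeff (a • chainVector (inflatedCharacter X f) (IsCoarsening X 0) F) =
        fun L => a * (sign K F.blocks * if L = F.blocks then 1 else 0) :=
      funext fun L => by
        rw [listCoeff_smul, listCoeff_chainVector hF]
        split_ifs with h <;> simp [h]
    have hp : F.blocks.Perm X.parts.toList := by
      rw [← hF.eq]
      exact (List.toFinset_toList F.isDisjoint_blocks.nodup).symm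
    rw [this, orderSum_mul, orderSum_mul, sign_mul_orderSum_single (isDisjoint_toList X).nodup hp,
      LinearMap.map_smul_of_tower, augmentation_chainVector f hF, mul_comm]
    exact congrArg (sign K X.parts.toList * ·) (mul_one a).symm

lemma augmentation_surjective : Function.Surjective (augmentation f) := by
  intro t
  obtain ⟨F, hF⟩ := exists_shape_eq X
  have hF' : IsCoarsening X 0 F.shape := by rw [hF]; exact ⟨le_rfl, rfl⟩
  refine ⟨(id t : K) • chainVector _ _ F, ?_⟩
  rw [LinearMap.map_smul_of_tower, augmentation_chainVector f hF']
  exact mul_one (id t : K)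

lemma exact_augmentation : Function.Exact
    (boundaryMap (inflatedCharacter X f) (IsCoarsening X 1) (IsCoarsening X 0))
    (augmentation f) := by
  intro c
  constructor
  · intro hc
    refine exists_boundaryMap_eq c (fun L hL => ?_) ?_
    -- The cocycle condition is empty in degree zero: it could fail only at lists with `|X| + 1`
    -- blocks, too many for a coarsening of `X`.
    · refine coboundary_listCoeff_of_length_ne c fun hk => ?_
      obtain ⟨F, rfl, hF⟩ := hL.exists_blocks_eq
      have h1 : F.shape.parts.card ≤ X.parts.card := Finpartition.card_mono hF
      rw [card_parts_shape] at h1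
      omega
    · rw [orderSum_listCoeff, hc]
      exact mul_zero (sign K X.parts.toList)
  · rintro ⟨b, rfl⟩
    have h1 := orderSum_listCoeff f
      (boundaryMap (inflatedCharacter X f) (IsCoarsening X 1) (IsCoarsening X 0) b)
    have h2 : orderSum X.parts.toList (listCoeff
        (boundaryMap (inflatedCharacter X f) (IsCoarsening X 1) (IsCoarsening X 0) b)) = 0 := by
      rw [← orderSum_coboundary X.parts.toList (listCoeff b), ← sub_eq_zero, sub_eq_add_neg,
        ← orderSum_neg, ← orderSum_add]
      refine orderSum_eq_zero fun M hM => ?_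
      rw [← sub_eq_add_neg, sub_eq_zero]
      have hp : IsOrderedPartition X.parts.toList M := by
        refine IsOrderedPartition.perm ?_ hM.symm
        exact ⟨isDisjoint_toList X, fun x hx => ⟨x, hx, subset_rfl⟩, fun P hP i hi => ⟨P, hP, hi⟩⟩
      refine listCoeff_boundaryMap b hp ?_
      rw [hM.length_eq, Finset.length_toList, add_zero]
    rw [h2] at h1
    have h3 := sign_mul_sign (K := K) X.parts.toList
    have h4 : sign K X.parts.toList ≠ 0 := fun h => by simp [h] at h3
    exact (mul_eq_zero.1 h1.symm).resolve_left h4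

end Exactness

/-! ### Computation of the Hom spaces and of `Ext` -/

section Conclusion

open OrderedSetPartition CategoryTheory

variable {n : ℕ} {K : Type u} [Field K] {G : Type v} [Group G] {X Y : SetPartition n}
  {f : X.parts → (G →* Kˣ)} {h : Y.parts → (G →* Kˣ)} {k : ℕ}

lemma inflatedCharacter_hsiaoOf_of_isCoarsening (F : OrderedSetPartition n)
    (hF : IsCoarsening X k F.shape) : inflatedCharacter X f (hsiaoOf F) = 1 :=
  inflatedCharacter_hsiaoOf f hF.1

lemma conditions_of_hom_ne_zero
    (φ : ChainModule (inflatedCharacter X f) (IsCoarsening X k)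
      →ₗ[MonoidAlgebra K (hsiaoMonoid n G)] HsiaoSimple Y h)
    {F : OrderedSetPartition n} (hF : IsCoarsening X k F.shape) (hφ : φ (chainVector _ _ F) ≠ 0) :
    IsCoarsening X k Y ∧ ∀ P : Y.parts, h P = ∏ Q : X.parts with Q.1 ⊆ P.1, f Q := by
  obtain ⟨rfl, hg⟩ :=
    shape_eq_of_hom_ne_zero inflatedCharacter_hsiaoOf_of_isCoarsening φ hF hφ
  refine ⟨hF, congrFun (blockCharacter_injective F.shape (MonoidHom.ext fun g => ?_))⟩
  have key := hg g
  have h1 : X ≤ (hsiaoMk F g).1.1.shape := hF.1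
  have h2 : F.shape ≤ (hsiaoMk F g).1.1.shape := le_rfl
  rw [inflatedCharacter_of_le f h1, inflatedCharacter_of_le h h2] at key
  rw [← blockCharacter_of_le hF.1]
  exact (Units.ext key).symm

lemma subsingleton_hom_hsiaoSimple
    (hY : ¬ (IsCoarsening X k Y ∧ ∀ P : Y.parts, h P = ∏ Q : X.parts with Q.1 ⊆ P.1, f Q)) :
    Subsingleton (ChainModule (inflatedCharacter X f) (IsCoarsening X k)
      →ₗ[MonoidAlgebra K (hsiaoMonoid n G)] HsiaoSimple Y h) := by
  refine subsingleton_of_forall_eq 0 fun φ => chainModule_linearMap_ext _ _ fun F hF => ?_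
  by_contra hφ
  exact hY (conditions_of_hom_ne_zero φ hF hφ)

lemma inflatedCharacter_eq_of_le (hXY : X ≤ Y)
    (hh : ∀ P : Y.parts, h P = ∏ Q : X.parts with Q.1 ⊆ P.1, f Q)
    (m : hsiaoMonoid n G) (hm : Y ≤ m.1.1.shape) :
    inflatedCharacter X f m = inflatedCharacter Y h m := by
  rw [inflatedCharacter_of_le h hm, inflatedCharacter_of_le f (hXY.trans hm), funext hh,
    ← blockCharacter_of_le hXY]

/-- A homomorphism is determined by its value at one `E` of shape `Y`: the other `F` of shape `Y`
take the same value, and all other shapes are sent to zero. Every value occurs by `simpleHom`. -/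
lemma nonempty_hom_linearEquiv (hY : IsCoarsening X k Y)
    (hh : ∀ P : Y.parts, h P = ∏ Q : X.parts with Q.1 ⊆ P.1, f Q) :
    letI : Module K (ModuleCat.of (MonoidAlgebra K (hsiaoMonoid n G))
        (ChainModule (inflatedCharacter X f) (IsCoarsening X k)) ⟶ hsiaoSimple Y h) :=
      Linear.homModule _ _
    Nonempty ((ModuleCat.of (MonoidAlgebra K (hsiaoMonoid n G))
      (ChainModule (inflatedCharacter X f) (IsCoarsening X k)) ⟶ hsiaoSimple Y h) ≃ₗ[K] K) := by
  let _ : Module K (ModuleCat.of (MonoidAlgebra K (hsiaoMonoid n G))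
      (ChainModule (inflatedCharacter X f) (IsCoarsening X k)) ⟶ hsiaoSimple Y h) :=
    Linear.homModule _ _
  obtain ⟨E, hE⟩ := exists_shape_eq Y
  have hE' : IsCoarsening X k E.shape := by rwa [hE]
  let eval : (ModuleCat.of (MonoidAlgebra K (hsiaoMonoid n G))
      (ChainModule (inflatedCharacter X f) (IsCoarsening X k)) ⟶ hsiaoSimple Y h) →ₗ[K] K :=
    { toFun φ := (id (φ.hom (chainVector (inflatedCharacter X f) (IsCoarsening X k) E) : HsiaoSimple Y h) : K)
      map_add' φ ψ := rfl
      map_smul' a φ := by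
        change MonoidAlgebra.lift K K (hsiaoMonoid n G) (inflatedCharacter Y h)
          (algebraMap K _ a) * (id (φ.hom (chainVector (inflatedCharacter X f) (IsCoarsening X k) E) : HsiaoSimple Y h) : K) = _
        rw [AlgHom.commutes]
        rfl }
  refine ⟨LinearEquiv.ofBijective eval ⟨?_, fun t => ?_⟩⟩
  · intro φ ψ hφψ
    refine ModuleCat.hom_ext (chainModule_linearMap_ext _ _ fun F hF => ?_)
    by_cases hFY : F.shape = Y
    · rw [hom_chainVector_eq inflatedCharacter_hsiaoOf_of_isCoarsening φ.hom hFY hE hY,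
        hom_chainVector_eq inflatedCharacter_hsiaoOf_of_isCoarsening ψ.hom hFY hE hY]
      exact hφψ
    · have h0 : ∀ φ : ChainModule (inflatedCharacter X f) (IsCoarsening X k)
          →ₗ[MonoidAlgebra K (hsiaoMonoid n G)] HsiaoSimple Y h, φ (chainVector _ _ F) = 0 := by
        intro φ
        by_contra hφ
        exact hFY (shape_eq_of_hom_ne_zero inflatedCharacter_hsiaoOf_of_isCoarsening φ hF hφ).1
      exact (h0 φ.hom).trans (h0 ψ.hom).symm
  · refine ⟨ModuleCat.ofHom (simpleHom _ _ Y h (inflatedCharacter_eq_of_le hY.1 hh)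
      (id t : HsiaoSimple Y h)), ?_⟩
    exact (simpleHom_chainVector _ _ Y h (inflatedCharacter_eq_of_le hY.1 hh)
      (id t : HsiaoSimple Y h) hE').trans (if_pos hE)

end Conclusion

theorem corollaryc {K : Type u} [Field K] {G : Type v} [CommGroup G] [Finite G]
    (hsplit : IsSplittingFieldFor K G) (hchar : ¬ ringChar K ∣ Nat.card G)
    (n : ℕ) (X Y : SetPartition n)
    (f : X.parts → (G →* Kˣ)) (h : Y.parts → (G →* Kˣ)) (q : ℕ) :
    ((X ≤ Y ∧ (q : ℤ) = (X.parts.card : ℤ) - (Y.parts.card : ℤ) ∧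
        ∀ P : Y.parts, h P = ∏ Q : X.parts with Q.1 ⊆ P.1, f Q) →
      Nonempty (CategoryTheory.Abelian.Ext.{u} (hsiaoSimple X f) (hsiaoSimple Y h) q ≃ₗ[K] K)) ∧
    (¬ (X ≤ Y ∧ (q : ℤ) = (X.parts.card : ℤ) - (Y.parts.card : ℤ) ∧
        ∀ P : Y.parts, h P = ∏ Q : X.parts with Q.1 ⊆ P.1, f Q) →
      Subsingleton (CategoryTheory.Abelian.Ext.{u} (hsiaoSimple X f) (hsiaoSimple Y h) q)) := by
  have hV : ∀ j, Module.Projective (MonoidAlgebra K (hsiaoMonoid n G))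
      (ChainModule (inflatedCharacter X f) (IsCoarsening X j)) := fun j =>
    projective_chainModule _ _ hchar inflatedCharacter_hsiaoOf_of_isCoarsening
  have hexact := fun j => exact_boundaryMap (χ := inflatedCharacter X f) (X := X) (k := j)
  constructor
  · rintro ⟨hXY, hq, hh⟩
    obtain ⟨e⟩ := nonempty_ext_linearEquiv_of_exact K
      (fun j => ChainModule (inflatedCharacter X f) (IsCoarsening X j))
      (fun j => boundaryMap (inflatedCharacter X f) _ _) (augmentation f)
      (augmentation_surjective f) (exact_augmentation f) hexact (T := HsiaoSimple Y h) q
      -- A nonzero map from degree `j` forces `|Y| + j = |X|`, so `j = q`.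
      (fun j hj => subsingleton_hom_hsiaoSimple fun hY => hj (by have := hY.1.2; omega))
    obtain ⟨e'⟩ := nonempty_hom_linearEquiv (f := f) (h := h) (k := q) ⟨hXY, by omega⟩ hh
    exact ⟨e.trans e'⟩
  · intro hY
    refine subsingleton_ext_of_exact
      (fun j => ChainModule (inflatedCharacter X f) (IsCoarsening X j))
      (fun j => boundaryMap (inflatedCharacter X f) _ _) (augmentation f)
      (augmentation_surjective f) (exact_augmentation f) hexact q
      (subsingleton_hom_hsiaoSimple fun hY' => hY ⟨hY'.1.1, ?_, hY'.2⟩)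
    have := hY'.1.2
    omega
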